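/- Let $a,b>0$. For $j\ge 0$ let $P_j^{(a-1,b-1)}$ be the Jacobi polynomial of degree $j$, and put $$h_j^{(a-1,b-1)}=\int_{-1}^{1}\bigl(P_j^{(a-1,b-1)}(t)\bigr)^2(1-t)^{a-1}(1+t)^{b-1}\,dt,$$ $$\varphi_j^{(4)}(x)=\frac{P_j^{(a-1,b-1)}(x)}{\sqrt{h_j^{(a-1,b-1)}}}\,(1-x)^{\frac a2-1}(1+x)^{\frac b2-1},\qquad -1<x<1,$$ $$S_N^{(4)}(x,y)=\sum_{j=0}^{2N}(1-x^2)\,\varphi_j^{(4)}(x)\,\varphi_j^{(4)}(y).$$ For real $\nu$ let $J_\nu$ denote the Bessel function of the first kind and let the Bessel kernel of order $\nu$ be $$K_{\mathrm{Bessel}}^{(\nu)}(x,y)=\frac{J_\nu(\sqrt x)\sqrt y\,J_\nu'(\sqrt y)-J_\nu'(\sqrt x)\sqrt x\,J_\nu(\sqrt y)}{2(x-y)}\quad (x\ne y),$$ extended to the diagonal by continuity, that is, $$K_{\mathrm{Bessel}}^{(\nu)}(x,x)=\tfrac14\left(J_\nu(\sqrt x)^2-J_{\nu+1}(\sqrt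 x)J_{\nu-1}(\sqrt x)\right),\qquad x,y>0.$$ Then for $x,y\in\mathbb{R}^+=(0,\infty)$, as $N\to\infty$, $$\frac{1}{8N^2}S_N^{(4)}\left(1-\frac{x}{8N^2},\,1-\frac{y}{8N^2}\right)=\sqrt{\frac xy}\;K_{\mathrm{Bessel}}^{(a-1)}(x,y)+O(N^{-1}),$$ and the error term is uniform for $x$ and $y$ in compact subsets of $\mathbb{R}^+$: for every compact $K\subset(0,\infty)$ there are a constant $C$ and an $N_0$, depending only on $a$, $b$ and $K$, such that for all $N\ge N_0$ and all $x,y\in K$ the two sides differ by at most $C/N$. -/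

import Mathlib

/-- The Jacobi polynomial `P_n^{(α,β)}` in its explicit form
`(1/n!) ∑_k C(n,k) (n+α+β+1)⋯(n+α+β+k) · (α+k+1)⋯(α+n) · ((x-1)/2)^k`. This is the usual
hypergeometric expression `((α+1)_n/n!) ₂F₁(-n, n+α+β+1; α+1; (1-x)/2)`, with the denominators
cleared. -/
noncomputable def jacobiP (α β : ℝ) (n : ℕ) (x : ℝ) : ℝ :=
  (1 / (n.factorial : ℝ)) * ∑ k ∈ Finset.range (n + 1),
    (n.choose k : ℝ) * (∏ i ∈ Finset.range k, ((n : ℝ) + α + β + 1 + i)) *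
      (∏ i ∈ Finset.Ico k n, (α + 1 + i)) * ((x - 1) / 2) ^ k

/-- The squared norm `h_n^{(α,β)} = ∫_{-1}^1 P_n^{(α,β)}(t)² (1-t)^α (1+t)^β dt`. -/
noncomputable def jacobiNormSq (α β : ℝ) (n : ℕ) : ℝ :=
  ∫ t in (-1 : ℝ)..1, jacobiP α β n t ^ 2 * ((1 - t) ^ α * (1 + t) ^ β)

/-- The function `φ_j^{(4)}` of the Jacobi symplectic ensemble with weight `(1-x)^a (1+x)^b`. -/
noncomputable def phi4 (a b : ℝ) (j : ℕ) (x : ℝ) : ℝ :=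
  jacobiP (a - 1) (b - 1) j x / √(jacobiNormSq (a - 1) (b - 1) j) *
    (1 - x) ^ (a / 2 - 1) * (1 + x) ^ (b / 2 - 1)

/-- The kernel `S_N^{(4)}(x,y) = ∑_{j=0}^{2N} (1-x²) φ_j^{(4)}(x) φ_j^{(4)}(y)`. -/
noncomputable def S4 (a b : ℝ) (N : ℕ) (x y : ℝ) : ℝ :=
  ∑ j ∈ Finset.range (2 * N + 1), (1 - x ^ 2) * phi4 a b j x * phi4 a b j y

/-- The Bessel function of the first kind `J_ν`, for a positive argument:
`J_ν(x) = ∑_k (-1)^k / (k! Γ(k+ν+1)) (x/2)^(2k+ν)`. At the poles of `Γ`, Mathlib's `Real.Gamma`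
is `0`, so the corresponding terms are `0`, which is the usual convention `1/Γ = 0` there. -/
noncomputable def besselJ (ν x : ℝ) : ℝ :=
  ∑' k : ℕ, (-1 : ℝ) ^ k / ((k.factorial : ℝ) * Real.Gamma (k + ν + 1)) *
    (x / 2) ^ (2 * (k : ℝ) + ν)

/-- The Bessel kernel of order `ν` on `(0,∞)²`, extended to the diagonal by continuity. -/
noncomputable def besselKernel (ν x y : ℝ) : ℝ :=
  if x = y then
    (besselJ ν √x ^ 2 - besselJ (ν + 1) √x * besselJ (ν - 1) √x) / 4
  else
    (besselJ ν √x * √y * deriv (besselJ ν) √y - deriv (besselJ ν) √x * √x * besselJ ν √y) /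
      (2 * (x - y))

/-! Since `1 - x²` is independent of the summation index, `S4` is an explicit prefactor times the
Christoffel-Darboux kernel of the Jacobi polynomials with parameters `(a-1, b-1)`. The factor `1 -
x²` acts on `x` alone, which is the source of `√(x/y)`. No asymptotics of individual polynomials are
needed: the kernel is expanded as a double power series about the endpoint `1` and compared with its
limit term by term.

In that series the coefficient of index `(k, l)` is a fixed `₀F₁` coefficient times the moment `∑
c_j p_k(j) p_l(j)`, with `c_j = P_j(1)²/h_j` and `p_k(j) ≈ j^(2k)`. The sum `C` of the `c_j` has a
closed form in Gamma functions and grows like `n^(2a)`, so the normalized masses behave like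
`d(t^(2a))` on `[0,1]`, and the moment divided by `C n^(2(k+l))` tends to `∫ t^(2(k+l)) d(t^(2a)) =
a/(a+k+l)`. `jacobiMoment_bound` proves this with error `F^(k+l)/(a n)`; the geometric factor only
enlarges the radius in an entire series, so summation gives a uniform `O(1/N)`
(`approxOn_jacobiKernel`).

The limiting series `hypKernel` satisfies a Christoffel-Darboux identity (`sub_mul_hypKernel`),
whose derivative on the diagonal gives `hypKernel_self`; together they identify it with the Bessel
kernel (`besselKernel_sub_one`). The prefactor is handled by `approxOn_jacobiMassSum`, that is, by
Gamma ratios. -/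

/-! ### Lowering and raising relations for Jacobi polynomials. -/

/-- The coefficient of `((x-1)/2)^k` in the Jacobi polynomial `P_n^{(α,β)}`. -/
noncomputable def jacobiCoeff (α β : ℝ) (n k : ℕ) : ℝ :=
  (1 / (n.factorial : ℝ)) * ((n.choose k : ℝ) *
    (∏ i ∈ Finset.range k, ((n : ℝ) + α + β + 1 + i)) * (∏ i ∈ Finset.Ico k n, (α + 1 + i)))

theorem jacobiP_eq_sum (α β : ℝ) (n : ℕ) (x : ℝ) :
    jacobiP α β n x = ∑ k ∈ Finset.range (n + 1), jacobiCoeff α β n k * ((x - 1) / 2) ^ k := by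
  simp only [jacobiP, jacobiCoeff, Finset.mul_sum, mul_assoc]

theorem prod_Ico_succ_shift (α : ℝ) (k n : ℕ) :
    ∏ i ∈ Finset.Ico (k + 1) (n + 1), (α + 1 + (i : ℝ)) =
      ∏ i ∈ Finset.Ico k n, (α + 1 + 1 + (i : ℝ)) := by
  rw [← Finset.prod_Ico_add' (fun i : ℕ => α + 1 + (i : ℝ)) k n 1]
  refine Finset.prod_congr rfl fun i _ => ?_
  push_cast; ring

theorem prod_range_succ_shift (c : ℝ) (k : ℕ) :
    ∏ i ∈ Finset.range (k + 1), (c + (i : ℝ)) =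
      c * ∏ i ∈ Finset.range k, (c + 1 + (i : ℝ)) := by
  rw [Finset.prod_range_succ', mul_comm]
  congr 1
  · simp
  · refine Finset.prod_congr rfl fun i _ => ?_
    push_cast; ring

theorem jacobiCoeff_deriv (α β : ℝ) (n k : ℕ) :
    ((k : ℝ) + 1) * jacobiCoeff α β (n + 1) (k + 1) =
      (n + α + β + 2) * jacobiCoeff (α + 1) (β + 1) n k := by
  have h1 : ((n : ℝ) + 1) * (n.choose k : ℝ) = ((n + 1).choose (k + 1) : ℝ) * (k + 1) := by
    exact_mod_cast Nat.add_one_mul_choose_eq n k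
  have h2 := prod_range_succ_shift ((n : ℝ) + 1 + α + β + 1) k
  have h3 := prod_Ico_succ_shift α k n
  have h4 : ((n + 1).factorial : ℝ) = (n + 1) * n.factorial := by
    push_cast [Nat.factorial_succ]; ring
  have hn : (n.factorial : ℝ) ≠ 0 := by positivity
  have hn1 : (n : ℝ) + 1 ≠ 0 := by positivity
  simp only [jacobiCoeff]
  push_cast
  rw [h2, h3, h4,
    show (n : ℝ) + 1 + α + β + 1 + 1 = (n : ℝ) + (α + 1) + (β + 1) + 1 by ring]
  field_simp
  linear_combination (-(n + α + β + 2) * (∏ i ∈ Finset.range k, ((n : ℝ) + (α + 1) + (β + 1) + 1 + i))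
    * ∏ i ∈ Finset.Ico k n, (α + 1 + 1 + (i : ℝ))) * h1

theorem jacobiCoeff_raise_zero (α β : ℝ) (n : ℕ) :
    ((n : ℝ) + 1) * jacobiCoeff α β (n + 1) 0 = (α + 1) * jacobiCoeff (α + 1) (β + 1) n 0 := by
  have h4 : ((n + 1).factorial : ℝ) = (n + 1) * n.factorial := by
    push_cast [Nat.factorial_succ]; ring
  have hn : (n.factorial : ℝ) ≠ 0 := by positivity
  have hn1 : (n : ℝ) + 1 ≠ 0 := by positivity
  have h2 := prod_range_succ_shift (α + 1) n
  simp only [jacobiCoeff, ← Finset.range_eq_Ico, h2, h4]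
  simp
  field_simp

theorem jacobiCoeff_raise_succ (α β : ℝ) (n k : ℕ) (hk : k ≤ n) :
    ((n : ℝ) + 1) * jacobiCoeff α β (n + 1) (k + 1) =
      (k + 1 + α + 1) * jacobiCoeff (α + 1) (β + 1) n (k + 1) +
        (k + α + β + 2) * jacobiCoeff (α + 1) (β + 1) n k := by
  have h4 : ((n + 1).factorial : ℝ) = (n + 1) * n.factorial := by
    push_cast [Nat.factorial_succ]; ring
  have hn : (n.factorial : ℝ) ≠ 0 := by positivity
  have hn1 : (n : ℝ) + 1 ≠ 0 := by positivity
  have h2 := prod_range_succ_shift ((n : ℝ) + 1 + α + β + 1) k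
  have h3 := prod_Ico_succ_shift α k n
  have h5 : ((n.choose (k + 1) : ℕ) : ℝ) * (k + 1) = n.choose k * (n - k) := by
    have := Nat.choose_succ_right_eq n k
    rw [← Nat.cast_sub hk]
    exact_mod_cast this
  have h6 : (((n + 1).choose (k + 1) : ℕ) : ℝ) = n.choose k + n.choose (k + 1) := by
    exact_mod_cast Nat.choose_succ_succ n k
  have h7 : (n.choose (k + 1) : ℝ) *
      ((k + 1 + α + 1) * ∏ i ∈ Finset.Ico (k + 1) n, (α + 1 + 1 + (i : ℝ))) =
      (n.choose (k + 1) : ℝ) * ∏ i ∈ Finset.Ico k n, (α + 1 + 1 + (i : ℝ)) := by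
    -- At `k = n` there is no bottom factor to split off, but the binomial coefficient vanishes.
    rcases hk.lt_or_eq with hlt | rfl
    · rw [Finset.prod_eq_prod_Ico_succ_bot hlt]
      ring
    · simp
  simp only [jacobiCoeff]
  rw [Finset.prod_range_succ (fun i : ℕ => (n : ℝ) + (α + 1) + (β + 1) + 1 + i)]
  push_cast
  rw [h2, h3, h4, h6,
    show (n : ℝ) + 1 + α + β + 1 + 1 = (n : ℝ) + (α + 1) + (β + 1) + 1 by ring]
  generalize (∏ i ∈ Finset.range k, ((n : ℝ) + (α + 1) + (β + 1) + 1 + i)) = R at *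
  generalize (∏ i ∈ Finset.Ico (k + 1) n, (α + 1 + 1 + (i : ℝ))) = S' at *
  generalize (∏ i ∈ Finset.Ico k n, (α + 1 + 1 + (i : ℝ))) = S at *
  field_simp
  linear_combination (-R * ((n : ℝ) + (α + 1) + (β + 1) + 1 + k)) * h7 - R * S * h5

/-- With `Q` the polynomial of parameters `(α+1, β+1)` in the variable `u = (x-1)/2`, the right side
is `u(1+u)Q' + (α+1+(α+β+2)u)Q`: the raising operator in coefficients. -/
theorem sum_jacobiCoeff_raise (α β : ℝ) (n : ℕ) (u : ℝ) :
    ((n : ℝ) + 1) * ∑ k ∈ Finset.range (n + 2), jacobiCoeff α β (n + 1) k * u ^ k =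
      ∑ k ∈ Finset.range (n + 1), ((k + α + 1) * jacobiCoeff (α + 1) (β + 1) n k * u ^ k +
        (k + α + β + 2) * jacobiCoeff (α + 1) (β + 1) n k * u ^ (k + 1)) := by
  have h0 : jacobiCoeff (α + 1) (β + 1) n (n + 1) = 0 := by simp [jacobiCoeff]
  have h1 : ∑ k ∈ Finset.range (n + 1), ((k : ℝ) + α + 1) * jacobiCoeff (α + 1) (β + 1) n k * u ^ k
      = ∑ k ∈ Finset.range (n + 2),
        ((k : ℝ) + α + 1) * jacobiCoeff (α + 1) (β + 1) n k * u ^ k := by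
    rw [Finset.sum_range_succ _ (n + 1), h0]; simp
  rw [Finset.sum_add_distrib, h1, Finset.sum_range_succ' _ (n + 1), Finset.sum_range_succ' _ (n + 1), mul_add,
    Finset.mul_sum, add_right_comm, ← Finset.sum_add_distrib]
  congr 1
  · refine Finset.sum_congr rfl fun k hk => ?_
    have := jacobiCoeff_raise_succ α β n k (by simpa [Nat.lt_succ_iff] using hk)
    push_cast
    linear_combination u ^ (k + 1) * this
  · have := jacobiCoeff_raise_zero α β n
    simp only [pow_zero, mul_one, Nat.cast_zero, zero_add]
    linear_combination this

theorem hasDerivAt_sum_pow (c : ℕ → ℝ) (n : ℕ) (x : ℝ) :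
    HasDerivAt (fun x : ℝ => ∑ k ∈ Finset.range n, c k * ((x - 1) / 2) ^ k)
      (∑ k ∈ Finset.range n, c k * (k * ((x - 1) / 2) ^ (k - 1) * (1 / 2))) x := by
  refine HasDerivAt.fun_sum fun k _ => ?_
  have h : HasDerivAt (fun x : ℝ => (x - 1) / 2) (1 / 2) x :=
    ((hasDerivAt_id x).sub_const 1).div_const 2
  exact (h.pow k).const_mul (c k)

theorem hasDerivAt_jacobiP_succ (α β : ℝ) (n : ℕ) (x : ℝ) :
    HasDerivAt (jacobiP α β (n + 1)) ((n + α + β + 2) / 2 * jacobiP (α + 1) (β + 1) n x) x := by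
  have h := hasDerivAt_sum_pow (jacobiCoeff α β (n + 1)) (n + 2) x
  rw [show jacobiP α β (n + 1) = _ from funext (jacobiP_eq_sum α β (n + 1)), jacobiP_eq_sum]
  convert h using 1
  rw [Finset.sum_range_succ' _ (n + 1), Finset.mul_sum]
  simp only [Nat.cast_zero, zero_mul, mul_zero, add_zero]
  refine Finset.sum_congr rfl fun k _ => ?_
  have := jacobiCoeff_deriv α β n k
  push_cast
  linear_combination (-1 / 2 * ((x - 1) / 2) ^ k) * this

/-- The left side of the identity is the derivative of `Q` times the weight with exponents `(α+1,
β+1)`, divided by the weight with exponents `(α, β)`: one step of Rodrigues' formula. -/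
theorem exists_hasDerivAt_jacobiP_raise (α β : ℝ) (n : ℕ) (x : ℝ) :
    ∃ d : ℝ, HasDerivAt (jacobiP (α + 1) (β + 1) n) d x ∧
      (1 - x ^ 2) * d + ((β + 1) * (1 - x) - (α + 1) * (1 + x)) * jacobiP (α + 1) (β + 1) n x =
        -2 * (n + 1) * jacobiP α β (n + 1) x := by
  have h := hasDerivAt_sum_pow (jacobiCoeff (α + 1) (β + 1) n) (n + 1) x
  rw [show jacobiP (α + 1) (β + 1) n = _ from funext (jacobiP_eq_sum (α + 1) (β + 1) n)]
  refine ⟨_, h, ?_⟩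
  have hs := sum_jacobiCoeff_raise α β n ((x - 1) / 2)
  rw [jacobiP_eq_sum α β (n + 1), mul_assoc, hs, Finset.mul_sum, Finset.mul_sum, Finset.mul_sum,
    ← Finset.sum_add_distrib]
  refine Finset.sum_congr rfl fun k _ => ?_
  set u := (x - 1) / 2 with hu
  have hx : x = 2 * u + 1 := by rw [hu]; ring
  clear_value u
  subst hx
  cases k with
  | zero => simp; ring
  | succ k => rw [Nat.add_sub_cancel]; push_cast; ring

/-! ### The squared norms in closed form. -/

theorem continuous_jacobiP (α β : ℝ) (n : ℕ) : Continuous (jacobiP α β n) := by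
  unfold jacobiP; fun_prop

theorem intervalIntegrable_jacobiWeight {α β : ℝ} (hα : -1 < α) (hβ : -1 < β) :
    IntervalIntegrable (fun t : ℝ => (1 - t) ^ α * (1 + t) ^ β) MeasureTheory.volume (-1) 1 := by
  have h1 : IntervalIntegrable (fun t : ℝ => (1 - t) ^ α) MeasureTheory.volume 0 1 := by
    have := (intervalIntegral.intervalIntegrable_rpow' (a := 0) (b := 1) hα).comp_sub_left 1
    simpa using this.symm
  have h2 : IntervalIntegrable (fun t : ℝ => (1 + t) ^ β) MeasureTheory.volume (-1) 0 := by
    have := (intervalIntegral.intervalIntegrable_rpow' (a := 0) (b := 1) hβ).comp_add_left 1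
    simpa using this
  refine IntervalIntegrable.trans (b := 0) ?_ ?_
  · refine h2.continuousOn_mul ?_
    intro t ht
    rw [Set.uIcc_of_le (by norm_num)] at ht
    have : (1 - t) ≠ 0 := by linarith [ht.2]
    exact ((continuousAt_const.sub continuousAt_id).rpow_const (Or.inl this)).continuousWithinAt
  · refine h1.mul_continuousOn ?_
    intro t ht
    rw [Set.uIcc_of_le (by norm_num)] at ht
    have : (1 + t) ≠ 0 := by linarith [ht.1]
    exact ((continuousAt_const.add continuousAt_id).rpow_const (Or.inl this)).continuousWithinAt

theorem hasDerivAt_jacobiWeight_succ (α β : ℝ) {x : ℝ} (hx : x ∈ Set.Ioo (-1 : ℝ) 1) :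
    HasDerivAt (fun t : ℝ => (1 - t) ^ (α + 1) * (1 + t) ^ (β + 1))
      (((β + 1) * (1 - x) - (α + 1) * (1 + x)) * ((1 - x) ^ α * (1 + x) ^ β)) x := by
  have hp : 0 < 1 - x := by linarith [hx.2]
  have hq : 0 < 1 + x := by linarith [hx.1]
  have h1 : HasDerivAt (fun t : ℝ => (1 - t) ^ (α + 1)) _ x :=
    ((hasDerivAt_id x).const_sub 1).rpow_const (p := α + 1) (Or.inl hp.ne')
  have h2 : HasDerivAt (fun t : ℝ => (1 + t) ^ (β + 1)) _ x :=
    ((hasDerivAt_id x).const_add 1).rpow_const (p := β + 1) (Or.inl hq.ne')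
  refine (h1.mul h2).congr_deriv ?_
  simp only [id, add_sub_cancel_right, Real.rpow_add hp, Real.rpow_add hq, Real.rpow_one]
  ring

/-- Lowering and raising are adjoint up to constants: integrate by parts. The boundary terms vanish
because `α + 1` and `β + 1` are positive. -/
theorem jacobiNormSq_succ {α β : ℝ} (hα : -1 < α) (hβ : -1 < β) (n : ℕ) :
    jacobiNormSq α β (n + 1) =
      (n + α + β + 2) / (4 * (n + 1)) * jacobiNormSq (α + 1) (β + 1) n := by
  set P := jacobiP α β (n + 1) with hP
  set Q := jacobiP (α + 1) (β + 1) n with hQ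
  have hPc : Continuous P := continuous_jacobiP _ _ _
  have hQc : Continuous Q := continuous_jacobiP _ _ _
  set c : ℝ := (n + α + β + 2) / 2
  have hI := intervalIntegrable_jacobiWeight hα hβ
  have hW : Continuous fun t : ℝ => (1 - t) ^ (α + 1) * (1 + t) ^ (β + 1) :=
    ((continuous_const.sub continuous_id).rpow_const fun _ => Or.inr (by linarith)).mul
      ((continuous_const.add continuous_id).rpow_const fun _ => Or.inr (by linarith))
  have key := intervalIntegral.integral_deriv_mul_eq_sub_of_hasDerivAt (a := -1) (b := 1)
    (u := P) (v := fun t => Q t * ((1 - t) ^ (α + 1) * (1 + t) ^ (β + 1)))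
    (u' := fun t => c * Q t)
    (v' := fun t => -2 * (n + 1) * P t * ((1 - t) ^ α * (1 + t) ^ β))
    hPc.continuousOn (hQc.mul hW).continuousOn
    (fun x _ => hasDerivAt_jacobiP_succ α β n x)
    (fun x hx => by
      have hx : x ∈ Set.Ioo (-1 : ℝ) 1 := by simpa using hx
      have hp : 0 < 1 - x := by linarith [hx.2]
      have hq : 0 < 1 + x := by linarith [hx.1]
      obtain ⟨d, hd, he⟩ := exists_hasDerivAt_jacobiP_raise α β n x
      refine (hd.mul (hasDerivAt_jacobiWeight_succ α β hx)).congr_deriv ?_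
      simp only [Real.rpow_add hp, Real.rpow_add hq, Real.rpow_one]
      linear_combination ((1 - x) ^ α * (1 + x) ^ β) * he)
    ((continuous_const.mul hQc).intervalIntegrable _ _)
    (hI.continuousOn_mul (continuous_const.mul hPc).continuousOn)
  rw [intervalIntegral.integral_add] at key
  · have e1 : ∫ t in (-1 : ℝ)..1, c * Q t * (Q t * ((1 - t) ^ (α + 1) * (1 + t) ^ (β + 1))) =
        c * jacobiNormSq (α + 1) (β + 1) n := by
      rw [jacobiNormSq, ← intervalIntegral.integral_const_mul]
      congr 1; ext t; ring
    have e2 : ∫ t in (-1 : ℝ)..1, P t * (-2 * (n + 1) * P t * ((1 - t) ^ α * (1 + t) ^ β)) =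
        -2 * (n + 1) * jacobiNormSq α β (n + 1) := by
      rw [jacobiNormSq, ← intervalIntegral.integral_const_mul]
      congr 1; ext t; ring
    rw [e1, e2] at key
    have ha : (0 : ℝ) ^ (α + 1) = 0 := Real.zero_rpow (by linarith)
    have hb : (0 : ℝ) ^ (β + 1) = 0 := Real.zero_rpow (by linarith)
    simp only [sub_self, add_neg_cancel, ha, hb, mul_zero, zero_mul] at key
    have hn : (n : ℝ) + 1 ≠ 0 := by positivity
    simp only [c] at key
    field_simp
    linarith
  · exact ((continuous_const.mul hQc).mul (hQc.mul hW)).intervalIntegrable _ _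
  · exact (hI.continuousOn_mul (continuous_const.mul hPc).continuousOn).continuousOn_mul
      hPc.continuousOn

theorem integral_rpow_mul_one_sub_rpow {u v : ℝ} (hu : 0 < u) (hv : 0 < v) :
    ∫ t in (0 : ℝ)..1, t ^ (u - 1) * (1 - t) ^ (v - 1) =
      Real.Gamma u * Real.Gamma v / Real.Gamma (u + v) := by
  have h := ProbabilityTheory.beta_eq_betaIntegralReal u v hu hv
  rw [ProbabilityTheory.beta] at h
  rw [h, Complex.betaIntegral]
  have : ∫ x in (0 : ℝ)..1, (x : ℂ) ^ ((u : ℂ) - 1) * (1 - (x : ℂ)) ^ ((v : ℂ) - 1) =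
      ∫ x in (0 : ℝ)..1, ((x ^ (u - 1) * (1 - x) ^ (v - 1) : ℝ) : ℂ) := by
    refine intervalIntegral.integral_congr fun x hx => ?_
    rw [Set.uIcc_of_le zero_le_one] at hx
    have h1 : 0 ≤ 1 - x := by linarith [hx.2]
    push_cast [Complex.ofReal_cpow hx.1, Complex.ofReal_cpow h1]
    rfl
  rw [this, intervalIntegral.integral_ofReal, Complex.ofReal_re]

theorem jacobiNormSq_zero {α β : ℝ} (hα : -1 < α) (hβ : -1 < β) :
    jacobiNormSq α β 0 = 2 ^ (α + β + 1) *
      (Real.Gamma (α + 1) * Real.Gamma (β + 1) / Real.Gamma (α + β + 2)) := by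
  have h := integral_rpow_mul_one_sub_rpow (u := β + 1) (v := α + 1) (by linarith) (by linarith)
  have h2 := intervalIntegral.integral_comp_mul_add (a := 0) (b := 1)
    (fun t : ℝ => (1 - t) ^ α * (1 + t) ^ β) (two_ne_zero (α := ℝ)) (-1)
  have hP : ∀ t, jacobiP α β 0 t = 1 := by intro t; simp [jacobiP]
  simp only [jacobiNormSq, hP, one_pow, one_mul]
  rw [show (2 : ℝ) * 0 + -1 = -1 by norm_num, show (2 : ℝ) * 1 + -1 = 1 by norm_num] at h2
  have h3 : ∫ x in (0 : ℝ)..1, (1 - (2 * x + -1)) ^ α * (1 + (2 * x + -1)) ^ β =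
      2 ^ (α + β) * ∫ t in (0 : ℝ)..1, t ^ β * (1 - t) ^ α := by
    rw [← intervalIntegral.integral_const_mul]
    refine intervalIntegral.integral_congr fun x hx => ?_
    rw [Set.uIcc_of_le zero_le_one] at hx
    have h1 : 0 ≤ 1 - x := by linarith [hx.2]
    rw [show 1 - (2 * x + -1) = 2 * (1 - x) by ring, show 1 + (2 * x + -1) = 2 * x by ring,
      Real.mul_rpow two_pos.le h1, Real.mul_rpow two_pos.le hx.1, Real.rpow_add two_pos]
    ring
  simp only [add_sub_cancel_right] at h
  rw [show β + 1 + (α + 1) = α + β + 2 by ring] at h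
  have h4 : ∫ x in (-1 : ℝ)..1, (1 - x) ^ α * (1 + x) ^ β =
      2 * (2 ^ (α + β) * ∫ t in (0 : ℝ)..1, t ^ β * (1 - t) ^ α) := by
    rw [← h3, h2, smul_eq_mul]; ring
  rw [h4, h, Real.rpow_add two_pos (α + β) 1, Real.rpow_one]
  ring

/-- Both parameters rise by one as the degree drops, so the induction quantifies over them. The
product is not written as a Gamma quotient, because `n + α + β + 1` may be nonpositive at `n = 0`.
-/
theorem jacobiNormSq_eq (n : ℕ) : ∀ {α β : ℝ}, -1 < α → -1 < β →
    jacobiNormSq α β n = (∏ i ∈ Finset.range n, ((n : ℝ) + α + β + 1 + i)) / n.factorial *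
      (2 ^ (α + β + 1) * (Real.Gamma (α + n + 1) * Real.Gamma (β + n + 1) /
        Real.Gamma (α + β + 2 * n + 2))) := by
  induction n with
  | zero => intro α β hα hβ; simp [jacobiNormSq_zero hα hβ]
  | succ n ih =>
    intro α β hα hβ
    rw [jacobiNormSq_succ hα hβ, ih (by linarith) (by linarith)]
    have h2 := prod_range_succ_shift ((n : ℝ) + 1 + α + β + 1) n
    push_cast [Nat.factorial_succ]
    rw [h2, show (n : ℝ) + 1 + α + β + 1 + 1 = (n : ℝ) + (α + 1) + (β + 1) + 1 by ring,
      show α + 1 + (β + 1) + 1 = α + β + 1 + 2 by ring, Real.rpow_add two_pos (α + β + 1) 2,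
      show α + 1 + (n : ℝ) + 1 = α + (n + 1) + 1 by ring,
      show β + 1 + (n : ℝ) + 1 = β + (n + 1) + 1 by ring,
      show α + 1 + (β + 1) + 2 * (n : ℝ) + 2 = α + β + 2 * (n + 1) + 2 by ring,
      show ((2 : ℝ) ^ (2 : ℝ)) = 4 by norm_num]
    have hn : (n.factorial : ℝ) ≠ 0 := by positivity
    have hn1 : (n : ℝ) + 1 ≠ 0 := by positivity
    have hG : Real.Gamma (α + β + 2 * (n + 1) + 2) ≠ 0 :=
      (Real.Gamma_pos_of_pos (by have := n.cast_nonneg (α := ℝ); linarith)).ne'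
    field_simp
    ring

theorem prod_range_add_mul_Gamma {x : ℝ} (hx : 0 < x) (k : ℕ) :
    (∏ i ∈ Finset.range k, (x + (i : ℝ))) * Real.Gamma x = Real.Gamma (x + k) := by
  induction k with
  | zero => simp
  | succ k ih =>
    have hk : (0 : ℝ) < x + k := by positivity
    rw [Finset.prod_range_succ, mul_right_comm, ih]
    push_cast
    rw [← add_assoc, Real.Gamma_add_one hk.ne', mul_comm]

/-! ### Endpoint masses and their partial sums. -/

/-- The value `P_j(1)² / h_j` for the Jacobi polynomials with parameters `(a-1, b-1)`. -/
noncomputable def jacobiMass (a b : ℝ) (j : ℕ) : ℝ :=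
  ((∏ i ∈ Finset.range j, (a + i)) / j.factorial) ^ 2 / jacobiNormSq (a - 1) (b - 1) j

/-- The value at `(1,1)` of the Christoffel-Darboux kernel of the Jacobi polynomials with
parameters `(a-1, b-1)`. -/
noncomputable def jacobiMassSum (a b : ℝ) (n : ℕ) : ℝ :=
  ∑ j ∈ Finset.range n, jacobiMass a b j

section mass

variable {a b : ℝ} (ha : 0 < a) (hb : 0 < b)
include ha hb

theorem jacobiNormSq_sub_one_pos (j : ℕ) : 0 < jacobiNormSq (a - 1) (b - 1) j := by
  rw [jacobiNormSq_eq j (by linarith) (by linarith)]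
  have h1 : 0 < ∏ i ∈ Finset.range j, ((j : ℝ) + (a - 1) + (b - 1) + 1 + i) := by
    refine Finset.prod_pos fun i hi => ?_
    have hj : 1 ≤ j := by have := Finset.mem_range.1 hi; omega
    have : (1 : ℝ) ≤ j := by exact_mod_cast hj
    have : (0 : ℝ) ≤ i := i.cast_nonneg
    linarith
  have hj : (0 : ℝ) ≤ j := j.cast_nonneg
  have h2 := Real.Gamma_pos_of_pos (show 0 < a - 1 + j + 1 by linarith)
  have h3 := Real.Gamma_pos_of_pos (show 0 < b - 1 + j + 1 by linarith)
  have h4 := Real.Gamma_pos_of_pos (show 0 < a - 1 + (b - 1) + 2 * j + 2 by linarith)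
  positivity

theorem jacobiMass_zero :
    jacobiMass a b 0 = Real.Gamma (a + b) /
      (2 ^ (a + b - 1) * Real.Gamma a * Real.Gamma b) := by
  rw [jacobiMass, jacobiNormSq_eq 0 (by linarith) (by linarith)]
  have h2 := Real.Gamma_pos_of_pos (show 0 < a + b by linarith)
  simp only [Finset.range_zero, Finset.prod_empty, Nat.factorial_zero, Nat.cast_zero, Nat.cast_one]
  rw [show a - 1 + 0 + 1 = a by ring, show b - 1 + 0 + 1 = b by ring,
    show a - 1 + (b - 1) + 2 * 0 + 2 = a + b by ring,
    show a - 1 + (b - 1) + 1 = a + b - 1 by ring]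
  field_simp

/-- Index `0` is treated apart: there the Gamma argument would be `a + b - 1`, which need not be
positive. -/
theorem jacobiMass_succ (n : ℕ) :
    jacobiMass a b (n + 1) = (2 * n + 1 + a + b) * Real.Gamma (n + a + b) *
      Real.Gamma (n + 1 + a) / (2 ^ (a + b - 1) * Real.Gamma a ^ 2 * (n + 1).factorial *
        Real.Gamma (n + 1 + b)) := by
  have hn : (0 : ℝ) ≤ n := n.cast_nonneg
  have hGa := Real.Gamma_pos_of_pos ha
  have h2 := Real.Gamma_pos_of_pos (show 0 < n + 1 + a by linarith)
  have h3 := Real.Gamma_pos_of_pos (show 0 < n + 1 + b by linarith)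
  have h5 := Real.Gamma_pos_of_pos (show 0 < n + a + b by linarith)
  have h6 := prod_range_add_mul_Gamma ha (n + 1)
  have h7 := prod_range_add_mul_Gamma (show 0 < n + a + b by linarith) (n + 1)
  have h8 := Real.Gamma_add_one (show (2 * n + 1 + a + b : ℝ) ≠ 0 by positivity)
  have h9 := Real.Gamma_pos_of_pos (show 0 < 2 * n + 1 + a + b by linarith)
  rw [jacobiMass, jacobiNormSq_eq (n + 1) (by linarith) (by linarith)]
  push_cast at h6 h7 ⊢
  rw [show a + ((n : ℝ) + 1) = n + 1 + a by ring] at h6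
  rw [show n + a + b + ((n : ℝ) + 1) = 2 * n + 1 + a + b by ring] at h7
  rw [show (n : ℝ) + 1 + (a - 1) + (b - 1) + 1 = n + a + b by ring,
    show a - 1 + ((n : ℝ) + 1) + 1 = n + 1 + a by ring,
    show b - 1 + ((n : ℝ) + 1) + 1 = n + 1 + b by ring,
    show a - 1 + (b - 1) + 2 * ((n : ℝ) + 1) + 2 = 2 * n + 1 + a + b + 1 by ring,
    show a - 1 + (b - 1) + 1 = a + b - 1 by ring, h8]
  rw [← eq_div_iff hGa.ne'] at h6
  rw [← eq_div_iff h5.ne'] at h7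
  rw [h6, h7]
  have h10 : (0 : ℝ) < 2 * n + 1 + a + b := by linarith
  field_simp

theorem jacobiMass_pos (j : ℕ) : 0 < jacobiMass a b j :=
  div_pos (by positivity) (jacobiNormSq_sub_one_pos ha hb j)

theorem jacobiMassSum_succ (n : ℕ) :
    jacobiMassSum a b (n + 1) = Real.Gamma (n + b + a) * Real.Gamma (n + 1 + a) /
      (2 ^ (a + b - 1) * Real.Gamma a * Real.Gamma (a + 1) * Real.Gamma (n + 1) *
        Real.Gamma (n + b)) := by
  have hGa := Real.Gamma_pos_of_pos ha
  have hGb := Real.Gamma_pos_of_pos hb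
  induction n with
  | zero =>
    rw [jacobiMassSum, Finset.sum_range_one, jacobiMass_zero ha hb]
    simp only [Nat.cast_zero, zero_add, Real.Gamma_one, mul_one]
    have h1 := Real.Gamma_pos_of_pos (show 0 < a + 1 by linarith)
    rw [add_comm 1 a, add_comm b a]
    field_simp
  | succ n ih =>
    have hn : (0 : ℝ) ≤ n := n.cast_nonneg
    have h1 := Real.Gamma_pos_of_pos (show 0 < n + 1 + a by linarith)
    have h2 := Real.Gamma_pos_of_pos (show 0 < n + b by linarith)
    have h3 := Real.Gamma_pos_of_pos (show 0 < n + b + a by linarith)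
    have h4 := Real.Gamma_pos_of_pos (show (0 : ℝ) < n + 1 by linarith)
    have h5 : Real.Gamma (n + 1 + b) = (n + b) * Real.Gamma (n + b) := by
      rw [← Real.Gamma_add_one (by linarith)]; congr 1; ring
    have h6 : Real.Gamma (n + 1 + b + a) = (n + b + a) * Real.Gamma (n + b + a) := by
      rw [← Real.Gamma_add_one (by linarith)]; congr 1; ring
    have h7 : Real.Gamma (n + 1 + 1 + a) = (n + 1 + a) * Real.Gamma (n + 1 + a) := by
      rw [← Real.Gamma_add_one (by linarith)]; congr 1; ring
    have h8 : Real.Gamma ((n : ℝ) + 1 + 1) = (n + 1) * Real.Gamma (n + 1) :=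
      Real.Gamma_add_one (by linarith)
    have h9 : ((n + 1).factorial : ℝ) = (n + 1) * Real.Gamma (n + 1) := by
      rw [Real.Gamma_nat_eq_factorial, Nat.factorial_succ]; push_cast; ring
    rw [jacobiMassSum, Finset.sum_range_succ, ← jacobiMassSum, ih, jacobiMass_succ ha hb n]
    push_cast
    rw [h6, h7, h8, h9, h5, Real.Gamma_add_one ha.ne', show (n : ℝ) + a + b = n + b + a by ring]
    have hnb : (0 : ℝ) < n + b := by linarith
    field_simp
    ring

/-- The ratio of partial sum to next mass is about `n/(2a)`, the discrete form of growth like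
`n^(2a)`. This drives the moment asymptotics. -/
theorem jacobiMassSum_telescope (n : ℕ) :
    a * (2 * n + 1 + a + b) * jacobiMassSum a b (n + 1) =
      (n + 1) * (n + b) * jacobiMass a b (n + 1) := by
  have hn : (0 : ℝ) ≤ n := n.cast_nonneg
  have hGa := Real.Gamma_pos_of_pos ha
  have h2 := Real.Gamma_pos_of_pos (show 0 < n + b by linarith)
  have h4 := Real.Gamma_pos_of_pos (show (0 : ℝ) < n + 1 by linarith)
  have h5 : Real.Gamma (n + 1 + b) = (n + b) * Real.Gamma (n + b) := by
    rw [← Real.Gamma_add_one (by linarith)]; congr 1; ring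
  have h9 : ((n + 1).factorial : ℝ) = (n + 1) * Real.Gamma (n + 1) := by
    rw [Real.Gamma_nat_eq_factorial, Nat.factorial_succ]; push_cast; ring
  rw [jacobiMassSum_succ ha hb, jacobiMass_succ ha hb, h9, h5, Real.Gamma_add_one ha.ne',
    show (n : ℝ) + a + b = n + b + a by ring]
  have hnb : (0 : ℝ) < n + b := by linarith
  field_simp

theorem jacobiMassSum_pos (n : ℕ) : 0 < jacobiMassSum a b (n + 1) :=
  Finset.sum_pos (fun j _ => jacobiMass_pos ha hb j) ⟨0, by simp⟩

end mass

/-! ### Calculus of uniform `O(1/N)` approximation. -/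

/-- `f N` converges to the bounded function `g` uniformly on `S`, with rate `O(1/N)`. -/
def ApproxOn {X : Type*} (S : Set X) (f : ℕ → X → ℝ) (g : X → ℝ) : Prop :=
  (∃ B : ℝ, ∀ p ∈ S, |g p| ≤ B) ∧
    ∃ (C : ℝ) (N₀ : ℕ), ∀ N : ℕ, N₀ ≤ N → ∀ p ∈ S, |f N p - g p| ≤ C / N

namespace ApproxOn

variable {X : Type*} {S : Set X} {f f₁ f₂ : ℕ → X → ℝ} {g g₁ g₂ : X → ℝ}

theorem congr (h : ApproxOn S f₁ g) (N₁ : ℕ)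
    (he : ∀ N : ℕ, N₁ ≤ N → ∀ p ∈ S, f₁ N p = f₂ N p) : ApproxOn S f₂ g := by
  obtain ⟨hB, C, N₀, hC⟩ := h
  refine ⟨hB, C, max N₀ N₁, fun N hN p hp => ?_⟩
  rw [← he N ((le_max_right _ _).trans hN) p hp]
  exact hC N ((le_max_left _ _).trans hN) p hp

theorem const (hg : ∃ B : ℝ, ∀ p ∈ S, |g p| ≤ B) : ApproxOn S (fun _ => g) g :=
  ⟨hg, 0, 0, fun N _ p _ => by simp⟩

/-- This is where boundedness of the limits is used: it also bounds `f₂ N` by `B₂ + |C₂|` once `N ≥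
1`. -/
theorem mul (h₁ : ApproxOn S f₁ g₁) (h₂ : ApproxOn S f₂ g₂) :
    ApproxOn S (fun N p => f₁ N p * f₂ N p) (fun p => g₁ p * g₂ p) := by
  obtain ⟨⟨B₁, hB₁⟩, C₁, N₁, h₁⟩ := h₁
  obtain ⟨⟨B₂, hB₂⟩, C₂, N₂, h₂⟩ := h₂
  refine ⟨⟨B₁ * B₂, fun p hp => ?_⟩, |C₁| * (B₂ + |C₂|) + B₁ * |C₂|,
    max (max N₁ N₂) 1, fun N hN p hp => ?_⟩
  · rw [abs_mul]
    exact mul_le_mul (hB₁ p hp) (hB₂ p hp) (abs_nonneg _) ((abs_nonneg _).trans (hB₁ p hp))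
  · have hN1 : (1 : ℝ) ≤ N := by exact_mod_cast (le_max_right _ _).trans hN
    have hN0 : (0 : ℝ) < N := by linarith
    have e₁ : |f₁ N p - g₁ p| ≤ |C₁| / N :=
      (h₁ N (((le_max_left _ _).trans (le_max_left _ _)).trans hN) p hp).trans
        (div_le_div_of_nonneg_right (le_abs_self _) hN0.le)
    have e₂ : |f₂ N p - g₂ p| ≤ |C₂| / N :=
      (h₂ N (((le_max_right _ _).trans (le_max_left _ _)).trans hN) p hp).trans
        (div_le_div_of_nonneg_right (le_abs_self _) hN0.le)
    have e₃ : |f₂ N p| ≤ B₂ + |C₂| := by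
      have : |C₂| / N ≤ |C₂| := div_le_self (abs_nonneg _) hN1
      have h3 := abs_sub_abs_le_abs_sub (f₂ N p) (g₂ p)
      linarith [hB₂ p hp]
    calc |f₁ N p * f₂ N p - g₁ p * g₂ p|
        = |(f₁ N p - g₁ p) * f₂ N p + g₁ p * (f₂ N p - g₂ p)| := by congr 1; ring
      _ ≤ |f₁ N p - g₁ p| * |f₂ N p| + |g₁ p| * |f₂ N p - g₂ p| := by
        rw [← abs_mul, ← abs_mul]; exact abs_add_le _ _
      _ ≤ |C₁| / N * (B₂ + |C₂|) + B₁ * (|C₂| / N) :=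
        add_le_add (mul_le_mul e₁ e₃ (abs_nonneg _) (by positivity))
          (mul_le_mul (hB₁ p hp) e₂ (abs_nonneg _) ((abs_nonneg _).trans (hB₁ p hp)))
      _ = (|C₁| * (B₂ + |C₂|) + B₁ * |C₂|) / N := by ring

theorem comp_two_mul (h : ApproxOn S f g) : ApproxOn S (fun N => f (2 * N)) g := by
  obtain ⟨hB, C, N₀, hC⟩ := h
  refine ⟨hB, |C|, max N₀ 1, fun N hN p hp => ?_⟩
  have hN1 : (1 : ℝ) ≤ N := by exact_mod_cast (le_max_right _ _).trans hN
  have hN0 : N₀ ≤ N := (le_max_left _ _).trans hN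
  refine (hC (2 * N) (by omega) p hp).trans ?_
  push_cast
  exact div_le_div₀ (abs_nonneg _) (le_abs_self _) (by linarith) (by linarith)

theorem squeeze (h₁ : ApproxOn S f₁ g) (h₂ : ApproxOn S f₂ g) (N₁ : ℕ)
    (he : ∀ N : ℕ, N₁ ≤ N → ∀ p ∈ S, f₁ N p ≤ f N p ∧ f N p ≤ f₂ N p) : ApproxOn S f g := by
  obtain ⟨hB, C₁, M₁, h₁⟩ := h₁
  obtain ⟨-, C₂, M₂, h₂⟩ := h₂
  refine ⟨hB, max C₁ C₂, max (max M₁ M₂) N₁, fun N hN p hp => ?_⟩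
  have a₁ := abs_le.1 (h₁ N (((le_max_left _ _).trans (le_max_left _ _)).trans hN) p hp)
  have a₂ := abs_le.1 (h₂ N (((le_max_right _ _).trans (le_max_left _ _)).trans hN) p hp)
  obtain ⟨b₁, b₂⟩ := he N ((le_max_right _ _).trans hN) p hp
  have c₁ : C₁ / N ≤ max C₁ C₂ / N :=
    div_le_div_of_nonneg_right (le_max_left _ _) N.cast_nonneg
  have c₂ : C₂ / N ≤ max C₁ C₂ / N :=
    div_le_div_of_nonneg_right (le_max_right _ _) N.cast_nonneg
  exact abs_le.2 ⟨by linarith, by linarith⟩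

/-- Differentiability of `(1+u)^r` at `0` gives a linear bound near `0`, and `D/N` eventually enters
that neighbourhood. -/
theorem one_add_rpow {t : ℕ → X → ℝ} (D : ℝ) (N₁ : ℕ)
    (ht : ∀ N : ℕ, N₁ ≤ N → ∀ p ∈ S, |t N p| ≤ D / N) (r : ℝ) :
    ApproxOn S (fun N p => (1 + t N p) ^ r) (fun _ => 1) := by
  refine ⟨⟨1, by simp⟩, ?_⟩
  have h1 : HasDerivAt (fun u : ℝ => (1 + u) ^ r) _ 0 :=
    ((hasDerivAt_id (0 : ℝ)).const_add 1).rpow_const (p := r) (Or.inl (by simp))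
  obtain ⟨c, hc⟩ := h1.isBigO_sub.bound
  obtain ⟨δ, hδ, hc⟩ := Metric.eventually_nhds_iff.1 hc
  obtain ⟨N₂, hN₂⟩ := exists_nat_gt (|D| / δ)
  refine ⟨|c| * |D|, max (max N₁ N₂) 1, fun N hN p hp => ?_⟩
  have hN1 : (1 : ℝ) ≤ N := by exact_mod_cast (le_max_right _ _).trans hN
  have hN0 : (0 : ℝ) < N := by linarith
  have hN2 : (N₂ : ℝ) ≤ N := by
    exact_mod_cast ((le_max_right _ _).trans (le_max_left _ _)).trans hN
  have h2 : |t N p| ≤ |D| / N :=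
    (ht N (((le_max_left _ _).trans (le_max_left _ _)).trans hN) p hp).trans
      (div_le_div_of_nonneg_right (le_abs_self _) hN0.le)
  have h3 : |D| / N < δ := by
    rw [div_lt_iff₀ hN0]; rw [div_lt_iff₀ hδ] at hN₂; nlinarith
  have h4 := hc (y := t N p) (by simpa using h2.trans_lt h3)
  simp only [add_zero, Real.one_rpow, sub_zero, Real.norm_eq_abs] at h4
  calc _ ≤ c * |t N p| := h4
    _ ≤ |c| * (|D| / N) :=
      mul_le_mul (le_abs_self _) h2 (abs_nonneg _) (abs_nonneg _)
    _ = _ := by ring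

end ApproxOn

/-! ### Gamma ratios and growth of the total mass. -/

/-- Log-convexity of Gamma between `x` and `x + 1`. -/
theorem Gamma_add_le_rpow_mul {x θ : ℝ} (hx : 0 < x) (h0 : 0 ≤ θ) (h1 : θ ≤ 1) :
    Real.Gamma (x + θ) ≤ x ^ θ * Real.Gamma x := by
  have hG := Real.Gamma_pos_of_pos hx
  rcases h0.eq_or_lt with rfl | h0
  · simp
  rcases h1.eq_or_lt with rfl | h1
  · rw [Real.Gamma_add_one hx.ne', Real.rpow_one]
  have h := Real.Gamma_mul_add_mul_le_rpow_Gamma_mul_rpow_Gamma hx (show 0 < x + 1 by linarith)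
    (show 0 < 1 - θ by linarith) h0 (by ring)
  rw [show (1 - θ) * x + θ * (x + 1) = x + θ by ring, Real.Gamma_add_one hx.ne',
    Real.mul_rpow hx.le hG.le, Real.rpow_sub hG, Real.rpow_one] at h
  have : Real.Gamma x ^ θ ≠ 0 := (Real.rpow_pos_of_pos hG θ).ne'
  refine h.trans_eq ?_
  field_simp

/-- The upper bound taken from `x + θ` to `x + 1`, read backwards. -/
theorem le_rpow_mul_Gamma_add {x θ : ℝ} (hx : 0 < x) (h0 : 0 ≤ θ) (h1 : θ ≤ 1) :
    x * (x + θ) ^ (θ - 1) * Real.Gamma x ≤ Real.Gamma (x + θ) := by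
  have h := Gamma_add_le_rpow_mul (x := x + θ) (θ := 1 - θ) (by linarith) (by linarith)
    (by linarith)
  have hp : 0 < x + θ := by linarith
  rw [show x + θ + (1 - θ) = x + 1 by ring, Real.Gamma_add_one hx.ne'] at h
  have h2 : (x + θ) ^ (θ - 1) * (x + θ) ^ (1 - θ) = 1 := by
    rw [← Real.rpow_add hp]; simp
  calc _ = (x + θ) ^ (θ - 1) * (x * Real.Gamma x) := by ring
    _ ≤ (x + θ) ^ (θ - 1) * ((x + θ) ^ (1 - θ) * Real.Gamma (x + θ)) :=
      mul_le_mul_of_nonneg_left h (by positivity)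
    _ = _ := by rw [← mul_assoc, h2, one_mul]

theorem approxOn_Gamma_ratio_of_le_one {X : Type*} (S : Set X) {c θ : ℝ} (hc : 0 < c)
    (h0 : 0 ≤ θ) (h1 : θ ≤ 1) :
    ApproxOn S (fun N _ => Real.Gamma (N + c + θ) / (Real.Gamma (N + c) * (N : ℝ) ^ θ))
      (fun _ => 1) := by
  have hr : ∀ d r : ℝ, ApproxOn S (fun N _ => (1 + d / N) ^ r) (fun _ => 1) := fun d r =>
    ApproxOn.one_add_rpow |d| 0 (fun N _ p _ => by rw [abs_div, Nat.abs_cast]) r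
  have hl := (hr c 1).mul (hr (c + θ) (θ - 1))
  rw [one_mul] at hl
  refine ApproxOn.squeeze hl (hr c θ) 1 fun N hN p _ => ?_
  have hN0 : (0 : ℝ) < N := by exact_mod_cast hN
  have hx : 0 < N + c := by linarith
  have hG := Real.Gamma_pos_of_pos hx
  have e1 : 1 + c / N = (N + c) / N := by field_simp
  have e2 : 1 + (c + θ) / N = (N + c + θ) / N := by field_simp; ring
  have hp : 0 < (N : ℝ) ^ θ := Real.rpow_pos_of_pos hN0 θ
  constructor
  · rw [e1, e2, le_div_iff₀ (by positivity), Real.rpow_one, Real.div_rpow (by linarith) hN0.le,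
      Real.rpow_sub hN0, Real.rpow_one]
    refine le_trans (le_of_eq ?_) (le_rpow_mul_Gamma_add hx h0 h1)
    field_simp
  · rw [e1, div_le_iff₀ (by positivity), Real.div_rpow hx.le hN0.le]
    refine (Gamma_add_le_rpow_mul hx h0 h1).trans (le_of_eq ?_)
    field_simp

/-- Write `a` as integer part plus fractional part; each integer step multiplies the ratio by `1 +
O(1/N)`. -/
theorem approxOn_Gamma_ratio {X : Type*} (S : Set X) {c a : ℝ} (hc : 0 < c) (ha : 0 ≤ a) :
    ApproxOn S (fun N _ => Real.Gamma (N + c + a) / (Real.Gamma (N + c) * (N : ℝ) ^ a))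
      (fun _ => 1) := by
  suffices H : ∀ (k : ℕ) (θ : ℝ), 0 ≤ θ → θ ≤ 1 → ApproxOn S (fun N _ =>
      Real.Gamma (N + c + (θ + k)) / (Real.Gamma (N + c) * (N : ℝ) ^ (θ + k))) (fun _ => 1) by
    have := H ⌊a⌋₊ (a - ⌊a⌋₊) (by linarith [Nat.floor_le ha])
      (by linarith [Nat.lt_floor_add_one a])
    simpa using this
  intro k θ h0 h1
  induction k with
  | zero => simpa using approxOn_Gamma_ratio_of_le_one S hc h0 h1
  | succ k ih =>
    have h := ih.mul (ApproxOn.one_add_rpow (S := S) (t := fun N _ => (c + (θ + k)) / N)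
      |c + (θ + k)| 0 (fun N _ p _ => by rw [abs_div, Nat.abs_cast]) 1)
    rw [one_mul] at h
    refine h.congr 1 fun N hN p _ => ?_
    have hN0 : (0 : ℝ) < N := by exact_mod_cast hN
    have hx : 0 < N + c := by linarith
    have hG := Real.Gamma_pos_of_pos hx
    have hk : (0 : ℝ) ≤ k := k.cast_nonneg
    have hp : 0 < (N : ℝ) ^ (θ + k) := Real.rpow_pos_of_pos hN0 _
    push_cast
    rw [← add_assoc θ, ← add_assoc (N + c : ℝ) (θ + k) 1, Real.Gamma_add_one (by positivity),
      Real.rpow_add hN0 _ 1, Real.rpow_one, Real.rpow_one]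
    field_simp
    ring

theorem approxOn_jacobiMassSum {X : Type*} (S : Set X) {a b : ℝ} (ha : 0 < a) (hb : 0 < b) :
    ApproxOn S (fun N _ => jacobiMassSum a b (2 * N + 1) / ((2 * N : ℕ) : ℝ) ^ (2 * a))
      (fun _ => 1 / (2 ^ (a + b - 1) * Real.Gamma a * Real.Gamma (a + 1))) := by
  have h := ((approxOn_Gamma_ratio S hb ha.le).mul (approxOn_Gamma_ratio S one_pos ha.le)).mul
    (ApproxOn.const (S := S)
      (g := fun _ => 1 / (2 ^ (a + b - 1) * Real.Gamma a * Real.Gamma (a + 1))) ⟨_, fun _ _ => le_rfl⟩)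
  simp only [one_mul] at h
  refine (h.congr (f₂ := fun N _ => jacobiMassSum a b (N + 1) / (N : ℝ) ^ (2 * a)) 1
    fun N hN p _ => ?_).comp_two_mul
  have hN0 : (0 : ℝ) < N := by exact_mod_cast hN
  rw [jacobiMassSum_succ ha hb, two_mul, Real.rpow_add hN0]
  field_simp

/-! ### Moments of the endpoint masses. -/

/-- The product `∏_{i<k} (j-i)(j+s+i)`, which up to sign is `(-j)_k (j+s)_k`. -/
noncomputable def pochPair (s : ℝ) (k j : ℕ) : ℝ :=
  ∏ i ∈ Finset.range k, (((j : ℝ) - i) * (j + s + i))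

theorem pochPair_succ (s : ℝ) (k j : ℕ) :
    pochPair s (k + 1) j = pochPair s k j * (((j : ℝ) - k) * (j + s + k)) :=
  Finset.prod_range_succ _ _

theorem pochPair_eq_zero (s : ℝ) {k j : ℕ} (h : j < k) : pochPair s k j = 0 :=
  Finset.prod_eq_zero (Finset.mem_range.2 h) (by simp)

theorem pochPair_bounds {s : ℝ} (hs : -1 < s) (k j : ℕ) :
    0 ≤ pochPair s k j ∧ pochPair s k j ≤ (2 + |s|) ^ k * (j : ℝ) ^ (2 * k) := by
  have hs0 : 0 ≤ |s| := abs_nonneg s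
  rcases lt_or_ge j k with h | h
  · rw [pochPair_eq_zero s h]
    exact ⟨le_rfl, by positivity⟩
  rw [pow_mul, ← mul_pow, pochPair]
  have hi : ∀ i ∈ Finset.range k, 0 ≤ ((j : ℝ) - i) * (j + s + i) ∧
      ((j : ℝ) - i) * (j + s + i) ≤ (2 + |s|) * (j : ℝ) ^ 2 := by
    intro i hi
    have hij : (i : ℝ) + 1 ≤ j := by exact_mod_cast (Finset.mem_range.1 hi).trans_le h
    have hi0 : (0 : ℝ) ≤ i := i.cast_nonneg
    have h1 : 0 ≤ (j : ℝ) + s + i := by linarith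
    refine ⟨mul_nonneg (by linarith) h1, ?_⟩
    have h2 : (j : ℝ) + s + i ≤ (2 + |s|) * j := by
      have := le_abs_self s
      nlinarith
    calc _ ≤ (j : ℝ) * ((2 + |s|) * j) := mul_le_mul (by linarith) h2 h1 (by linarith)
      _ = _ := by ring
  refine ⟨Finset.prod_nonneg fun i h => (hi i h).1, ?_⟩
  refine (Finset.prod_le_prod (fun i h => (hi i h).1) fun i h => (hi i h).2).trans_eq ?_
  simp only [Finset.prod_const, Finset.card_range]

/-- Each factor is `j² + O(j)`. The relative error is stated after multiplication by `j`, so that `j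
= 0` is included. -/
theorem pochPair_sub_pow_le {s : ℝ} (hs : -1 < s) (k j : ℕ) :
    (j : ℝ) * |pochPair s k j - (j : ℝ) ^ (2 * k)| ≤
      k * ((1 + |s|) * (1 + k) ^ 2) * (2 + |s|) ^ k * (j : ℝ) ^ (2 * k) := by
  have hs0 : 0 ≤ |s| := abs_nonneg s
  induction k with
  | zero => simp [pochPair]
  | succ k ih =>
    have hk0 : (0 : ℝ) ≤ k := k.cast_nonneg
    have hj0 : (0 : ℝ) ≤ j := j.cast_nonneg
    have hB1 : ∀ i : ℕ, 1 ≤ (2 + |s|) ^ i := fun i => one_le_pow₀ (by linarith)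
    -- Here the product vanishes, and the bound reduces to `j ≤ k + 1`.
    rcases lt_or_ge j (k + 1) with h | h
    · rw [pochPair_eq_zero s h, zero_sub, abs_neg, abs_of_nonneg (by positivity)]
      refine mul_le_mul_of_nonneg_right ?_ (by positivity)
      have h1 : (j : ℝ) ≤ ((k + 1 : ℕ) : ℝ) := by exact_mod_cast h.le
      have h2 : 1 ≤ (1 + |s|) * (1 + ((k + 1 : ℕ) : ℝ)) ^ 2 := by
        push_cast; nlinarith [mul_nonneg hs0 hk0]
      calc (j : ℝ) ≤ ((k + 1 : ℕ) : ℝ) * 1 * 1 := by linarith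
        _ ≤ _ := mul_le_mul (mul_le_mul_of_nonneg_left h2 (by positivity)) (hB1 _) zero_le_one
          (by positivity)
    · have hjk : (k : ℝ) + 1 ≤ j := by exact_mod_cast h
      rw [pochPair_succ]
      obtain ⟨q, hq⟩ : ∃ q, q = ((j : ℝ) - k) * (j + s + k) := ⟨_, rfl⟩
      rw [← hq]
      set J := (j : ℝ)
      set P := pochPair s k j
      have hq0 : 0 ≤ q := hq ▸ mul_nonneg (by linarith) (by linarith)
      have hqB : q ≤ (2 + |s|) * J ^ 2 := by
        rw [hq]
        have h2 : J + s + k ≤ (2 + |s|) * J := by nlinarith [le_abs_self s]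
        calc _ ≤ J * ((2 + |s|) * J) := mul_le_mul (by linarith) h2 (by linarith) (by linarith)
          _ = _ := by ring
      have hqd : J * |q - J ^ 2| ≤ (1 + |s|) * (1 + k) ^ 2 * J ^ 2 := by
        have e : q - J ^ 2 = s * J - k * (s + k) := by rw [hq]; ring
        have h1 : |q - J ^ 2| ≤ |s| * J + k * (|s| + k) := by
          rw [e]
          refine (abs_sub _ _).trans ?_
          rw [abs_mul, abs_mul, abs_of_nonneg hj0, abs_of_nonneg hk0]
          have := abs_add_le s k
          rw [abs_of_nonneg hk0] at this
          gcongr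
        have h2 : |s| * J + k * (|s| + k) ≤ (1 + |s|) * (1 + k) ^ 2 * J := by
          have h3 : (k : ℝ) * (|s| + k) ≤ k * (|s| + k) * J :=
            le_mul_of_one_le_right (by positivity) (by linarith)
          have h4 : |s| + k * (|s| + k) ≤ (1 + |s|) * (1 + k) ^ 2 := by
            nlinarith [mul_nonneg hs0 hk0, mul_nonneg hs0 (sq_nonneg (k : ℝ))]
          calc _ ≤ (|s| + k * (|s| + k)) * J := by linarith
            _ ≤ _ := mul_le_mul_of_nonneg_right h4 hj0
        calc _ ≤ J * ((1 + |s|) * (1 + k) ^ 2 * J) :=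
              mul_le_mul_of_nonneg_left (h1.trans h2) hj0
          _ = _ := by ring
      have hmono : (1 + |s|) * (1 + (k : ℝ)) ^ 2 ≤ (1 + |s|) * (1 + ((k + 1 : ℕ) : ℝ)) ^ 2 := by
        push_cast; gcongr; linarith
      calc J * |P * q - J ^ (2 * (k + 1))|
          = J * |(P - J ^ (2 * k)) * q + J ^ (2 * k) * (q - J ^ 2)| := by congr 2; ring
        _ ≤ J * (|P - J ^ (2 * k)| * q + J ^ (2 * k) * |q - J ^ 2|) := by
          refine mul_le_mul_of_nonneg_left ((abs_add_le _ _).trans_eq ?_) hj0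
          rw [abs_mul, abs_mul, abs_of_nonneg hq0, abs_of_nonneg (by positivity : 0 ≤ J ^ (2 * k))]
        _ = J * |P - J ^ (2 * k)| * q + J ^ (2 * k) * (J * |q - J ^ 2|) := by ring
        _ ≤ (k * ((1 + |s|) * (1 + k) ^ 2) * (2 + |s|) ^ k * J ^ (2 * k)) * ((2 + |s|) * J ^ 2) +
            J ^ (2 * k) * ((1 + |s|) * (1 + k) ^ 2 * J ^ 2) := by
          gcongr
        _ = (k * (2 + |s|) ^ (k + 1) + 1) * ((1 + |s|) * (1 + k) ^ 2) * J ^ (2 * (k + 1)) := by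
          ring
        _ ≤ (k * (2 + |s|) ^ (k + 1) + (2 + |s|) ^ (k + 1)) *
            ((1 + |s|) * (1 + ((k + 1 : ℕ) : ℝ)) ^ 2) * J ^ (2 * (k + 1)) := by
          gcongr
          exact hB1 _
        _ = _ := by push_cast; ring

/-- The polynomial factor in `k` is absorbed by `k(1+k)² ≤ 8^k`; the later double series tolerates
only geometric loss for free. -/
theorem exists_pochPair_bound {s : ℝ} (hs : -1 < s) :
    ∃ E : ℝ, 1 ≤ E ∧ ∀ k j : ℕ, 0 ≤ pochPair s k j ∧ pochPair s k j ≤ E ^ k * (j : ℝ) ^ (2 * k) ∧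
      (j : ℝ) * |pochPair s k j - (j : ℝ) ^ (2 * k)| ≤ E ^ k * (j : ℝ) ^ (2 * k) := by
  have hs0 : 0 ≤ |s| := abs_nonneg s
  refine ⟨8 * (1 + |s|) * (2 + |s|), by nlinarith, fun k j => ?_⟩
  obtain ⟨h1, h2⟩ := pochPair_bounds hs k j
  refine ⟨h1, h2.trans ?_, (pochPair_sub_pow_le hs k j).trans ?_⟩
  · gcongr
    nlinarith
  · refine mul_le_mul_of_nonneg_right ?_ (by positivity)
    rw [mul_pow]
    refine mul_le_mul_of_nonneg_right ?_ (by positivity)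
    rcases k.eq_zero_or_pos with rfl | hk
    · simp
    have h3 : (1 : ℝ) + k ≤ 2 ^ k := by
      have := one_add_mul_le_pow (a := (1 : ℝ)) (by norm_num) k
      norm_num at this
      linarith
    have h4 : 1 + |s| ≤ (1 + |s|) ^ k := le_self_pow₀ (by linarith) hk.ne'
    calc (k : ℝ) * ((1 + |s|) * (1 + k) ^ 2) ≤ 2 ^ k * ((1 + |s|) ^ k * (2 ^ k) ^ 2) := by
          gcongr
          linarith
      _ = _ := by rw [mul_pow, ← pow_mul, mul_comm k 2, pow_mul, show (8 : ℝ) = 2 * 2 ^ 2 by norm_num,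
          mul_pow]; ring

/-- The backward difference of `J^M` is `M J^(M-1)` up to a relative error `O(1/J)`, with the
dependence on `M` explicit. -/
theorem mul_pow_sub_pow_pred_bounds {J : ℝ} (hJ : 1 ≤ J) (M : ℕ) :
    0 ≤ M * J ^ M - J * (J ^ M - (J - 1) ^ M) ∧
      J * (M * J ^ M - J * (J ^ M - (J - 1) ^ M)) ≤ M ^ 2 * J ^ M := by
  induction M with
  | zero => simp
  | succ M ih =>
    obtain ⟨h1, h2⟩ := ih
    have hM : (0 : ℝ) ≤ M := M.cast_nonneg
    have hp : 0 ≤ J ^ M := by positivity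
    have e : ((M + 1 : ℕ) : ℝ) * J ^ (M + 1) - J * (J ^ (M + 1) - (J - 1) ^ (M + 1)) =
        M * J ^ M + (J - 1) * (M * J ^ M - J * (J ^ M - (J - 1) ^ M)) := by
      push_cast; ring
    rw [e]
    set e' := M * J ^ M - J * (J ^ M - (J - 1) ^ M)
    refine ⟨add_nonneg (by positivity) (mul_nonneg (by linarith) h1), ?_⟩
    have h3 : (J - 1) * (J * e') ≤ J * (M ^ 2 * J ^ M) :=
      mul_le_mul (by linarith) h2 (mul_nonneg (by linarith) h1) (by linarith)
    have h4 : 0 ≤ J * J ^ M := by positivity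
    push_cast
    rw [pow_succ J M]
    nlinarith [mul_nonneg hM h4]

section moments

variable {a b : ℝ}

/-- The moment `∑_{j<n} c_j ∏_{i<k} (λ_j - λ_i) ∏_{i<l} (λ_j - λ_i)` with `λ_j = j(j+a+b-1)`. -/
noncomputable def jacobiMoment (a b : ℝ) (k l n : ℕ) : ℝ :=
  ∑ j ∈ Finset.range n, jacobiMass a b j * (pochPair (a + b - 1) k j * pochPair (a + b - 1) l j)

theorem mul_abs_mul_sub_pow_le {J E P Q : ℝ} {k l : ℕ} (hJ : 0 ≤ J) (hE : 1 ≤ E) (hQ0 : 0 ≤ Q)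
    (hP : J * |P - J ^ (2 * k)| ≤ E ^ k * J ^ (2 * k)) (hQ1 : Q ≤ E ^ l * J ^ (2 * l))
    (hQ : J * |Q - J ^ (2 * l)| ≤ E ^ l * J ^ (2 * l)) :
    J * |P * Q - J ^ (2 * (k + l))| ≤ 2 * E ^ (k + l) * J ^ (2 * (k + l)) := by
  have hW : J ^ (2 * (k + l)) = J ^ (2 * k) * J ^ (2 * l) := by rw [mul_add, pow_add]
  have hEl : E ^ l * J ^ (2 * l) ≤ E ^ k * E ^ l * J ^ (2 * l) :=
    mul_le_mul_of_nonneg_right (le_mul_of_one_le_left (by positivity) (one_le_pow₀ hE))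
      (by positivity)
  calc J * |P * Q - J ^ (2 * (k + l))|
      = J * |(P - J ^ (2 * k)) * Q + J ^ (2 * k) * (Q - J ^ (2 * l))| := by
        rw [hW]; congr 2; ring
    _ ≤ J * (|P - J ^ (2 * k)| * Q + J ^ (2 * k) * |Q - J ^ (2 * l)|) := by
        refine mul_le_mul_of_nonneg_left ((abs_add_le _ _).trans_eq ?_) hJ
        rw [abs_mul, abs_mul, abs_of_nonneg hQ0, abs_of_nonneg (by positivity : 0 ≤ J ^ (2 * k))]
    _ = J * |P - J ^ (2 * k)| * Q + J ^ (2 * k) * (J * |Q - J ^ (2 * l)|) := by ring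
    _ ≤ (E ^ k * J ^ (2 * k)) * (E ^ l * J ^ (2 * l)) +
        J ^ (2 * k) * (E ^ k * E ^ l * J ^ (2 * l)) :=
        add_le_add (mul_le_mul hP hQ1 hQ0 (by positivity))
          (mul_le_mul_of_nonneg_left (hQ.trans hEl) (by positivity))
    _ = 2 * E ^ (k + l) * J ^ (2 * (k + l)) := by rw [hW, pow_add]; ring

theorem mul_abs_ratio_sub_half_le {a b J : ℝ} (ha : 0 < a) (hb : 0 < b) (hJ : 1 ≤ J) :
    J * |(J - 1 + b) / (2 * (J - 1) + 1 + a + b) - 1 / 2| ≤ a + b + 1 := by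
  have hden : J ≤ 2 * (J - 1) + 1 + a + b := by linarith
  have hden0 : 0 < 2 * (J - 1) + 1 + a + b := by linarith
  have : (J - 1 + b) / (2 * (J - 1) + 1 + a + b) - 1 / 2 =
      (b - a - 1) / (2 * (2 * (J - 1) + 1 + a + b)) := by
    rw [div_sub_div _ _ hden0.ne' two_ne_zero, div_eq_div_iff (by positivity) (by positivity)]
    ring
  rw [this, abs_div, abs_of_pos (by positivity : 0 < 2 * (2 * (J - 1) + 1 + a + b)),
    ← mul_div_assoc, div_le_iff₀ (by positivity), mul_comm (a + b + 1)]
  have : |b - a - 1| ≤ a + b + 1 := abs_le.2 ⟨by linarith, by linarith⟩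
  exact mul_le_mul (by linarith) this (abs_nonneg _) (by positivity)

theorem increment_constant_le {a E G : ℝ} (ha : 0 < a) (hE : 1 ≤ E) (hG : 0 < G) {m : ℕ}
    (hm : 0 < m) :
    (a + m) * (2 * E ^ m) + 2 * m * G + (1 + G) * ((2 * m : ℕ) : ℝ) ^ 2 ≤
      (4 * E * (2 * (a + 1) + 2 * G + 4 * (1 + G))) ^ m := by
  have hm1 : (1 : ℝ) ≤ (m : ℝ) := by exact_mod_cast hm
  have hem : 1 ≤ E ^ m := one_le_pow₀ hE
  have hm2 : (m : ℝ) ≤ (m : ℝ) ^ 2 := by nlinarith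
  have hm3 : (m : ℝ) ^ 2 ≤ (m : ℝ) ^ 2 * E ^ m := le_mul_of_one_le_right (by positivity) hem
  have c1 : a + m ≤ (m : ℝ) ^ 2 * (a + 1) := by nlinarith
  have h3 : (m : ℝ) ≤ 2 ^ m := by exact_mod_cast Nat.lt_two_pow_self.le
  have h4 : 2 * (a + 1) + 2 * G + 4 * (1 + G) ≤ (2 * (a + 1) + 2 * G + 4 * (1 + G)) ^ m :=
    le_self_pow₀ (by linarith) hm.ne'
  calc (a + m) * (2 * E ^ m) + 2 * m * G + (1 + G) * ((2 * m : ℕ) : ℝ) ^ 2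
      = (a + m) * (2 * E ^ m) + m * (2 * G) + (m : ℝ) ^ 2 * (4 * (1 + G)) := by push_cast; ring
    _ ≤ (m : ℝ) ^ 2 * (a + 1) * (2 * E ^ m) + (m : ℝ) ^ 2 * E ^ m * (2 * G) +
        (m : ℝ) ^ 2 * E ^ m * (4 * (1 + G)) :=
      add_le_add (add_le_add (mul_le_mul_of_nonneg_right c1 (by positivity))
        (mul_le_mul_of_nonneg_right (hm2.trans hm3) (by positivity)))
        (mul_le_mul_of_nonneg_right hm3 (by positivity))
    _ = (m : ℝ) ^ 2 * E ^ m * (2 * (a + 1) + 2 * G + 4 * (1 + G)) := by ring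
    _ ≤ (2 ^ m) ^ 2 * E ^ m * (2 * (a + 1) + 2 * G + 4 * (1 + G)) ^ m := by
      gcongr
    _ = _ := by
      rw [mul_pow, mul_pow, ← pow_mul, mul_comm m 2, pow_mul]; norm_num

/-- Put `m = k + l`. By the product rule and `C ≈ n c/(2a)`, the increment of `C n^(2m)` is about `c
n^(2m) + 2m C n^(2m-1) ≈ (1 + m/a) c n^(2m)`. Hence `a` times it matches `a + m` times the increment
of the moment. -/
theorem jacobiMoment_increment_bound (ha : 0 < a) (hb : 0 < b) :
    ∃ F : ℝ, 1 ≤ F ∧ ∀ k l n : ℕ, 0 < k + l →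
      ((n : ℝ) + 1) * |(a + (k + l : ℕ)) * (pochPair (a + b - 1) k (n + 1) *
          pochPair (a + b - 1) l (n + 1)) * jacobiMass a b (n + 1)
          - a * (jacobiMassSum a b (n + 2) * ((n : ℝ) + 1) ^ (2 * (k + l)) -
            jacobiMassSum a b (n + 1) * (n : ℝ) ^ (2 * (k + l)))| ≤
        F ^ (k + l) * ((n : ℝ) + 1) ^ (2 * (k + l)) * jacobiMass a b (n + 1) := by
  obtain ⟨E, hE, hP⟩ := exists_pochPair_bound (s := a + b - 1) (by linarith)
  obtain ⟨G, hG⟩ : ∃ G, G = a + b + 1 := ⟨_, rfl⟩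
  have hG0 : 0 < G := by linarith
  refine ⟨4 * E * (2 * (a + 1) + 2 * G + 4 * (1 + G)), by nlinarith, fun k l n hm => ?_⟩
  obtain ⟨-, -, p2⟩ := hP k (n + 1)
  obtain ⟨q0, q1, q2⟩ := hP l (n + 1)
  have hc := jacobiMass_pos ha hb (n + 1)
  have ht := jacobiMassSum_telescope ha hb n
  have hsum : jacobiMassSum a b (n + 2) = jacobiMassSum a b (n + 1) + jacobiMass a b (n + 1) :=
    Finset.sum_range_succ _ _
  rw [hsum]
  push_cast at p2 q1 q2
  have hF := increment_constant_le ha hE hG0 hm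
  generalize 4 * E * (2 * (a + 1) + 2 * G + 4 * (1 + G)) = F at hF ⊢
  have hn0 : (0 : ℝ) ≤ n := n.cast_nonneg
  have hPQ := mul_abs_mul_sub_pow_le (by linarith) hE q0 p2 q1 q2
  generalize pochPair (a + b - 1) k (n + 1) = P at *
  generalize pochPair (a + b - 1) l (n + 1) = Q at *
  generalize jacobiMass a b (n + 1) = c at *
  generalize jacobiMassSum a b (n + 1) = S at *
  generalize k + l = m at *
  clear p2 q1 q2 hsum hP
  obtain ⟨J, hJ⟩ : ∃ J : ℝ, J = n + 1 := ⟨_, rfl⟩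
  rw [← hJ] at ht hPQ ⊢
  have hJ1 : 1 ≤ J := by linarith
  have hJ0 : 0 < J := by linarith
  have hn : (n : ℝ) = J - 1 := by linarith
  rw [hn] at ht ⊢
  obtain ⟨e0, e1⟩ := mul_pow_sub_pow_pred_bounds hJ1 (2 * m)
  have hW0 : 0 < J ^ (2 * m) := by positivity
  generalize J ^ (2 * m) = W at *
  -- The three error sources are `P * Q - W`, the backward-difference error `e`, and `V - 1/2`,
  -- where `a * S = J * V * c`.
  obtain ⟨e, he⟩ : ∃ e, e = ((2 * m : ℕ) : ℝ) * W - J * (W - (J - 1) ^ (2 * m)) := ⟨_, rfl⟩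
  rw [← he] at e0 e1
  have hV2 := mul_abs_ratio_sub_half_le ha hb hJ1
  have hden0 : 0 < 2 * (J - 1) + 1 + a + b := by linarith
  have hSV : a * S = J * ((J - 1 + b) / (2 * (J - 1) + 1 + a + b)) * c := by
    rw [mul_div_assoc', div_mul_eq_mul_div, eq_div_iff hden0.ne']
    rw [← ht]; ring
  rw [← hG] at hV2
  generalize (J - 1 + b) / (2 * (J - 1) + 1 + a + b) = V at *
  have hV3 : |V - 1 / 2| ≤ G := le_trans (le_mul_of_one_le_left (abs_nonneg _) hJ1) hV2
  have hV1 : |V| ≤ 1 + G := by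
    have := abs_add_le (V - 1 / 2) (1 / 2)
    rw [sub_add_cancel, abs_of_pos (by norm_num : (0 : ℝ) < 1 / 2)] at this
    linarith
  have key : (a + m) * (P * Q) * c - a * ((S + c) * W - S * (J - 1) ^ (2 * m)) =
      c * ((a + m) * (P * Q - W) - 2 * m * W * (V - 1 / 2) + V * e) := by
    rw [he]; push_cast
    linear_combination (-(W - (J - 1) ^ (2 * m))) * hSV
  have b1 : |(a + m) * (P * Q - W) - 2 * m * W * (V - 1 / 2) + V * e| ≤
      (a + m) * |P * Q - W| + 2 * m * W * |V - 1 / 2| + |V| * e := by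
    refine (abs_add_le _ _).trans (add_le_add ((abs_sub _ _).trans_eq ?_) ?_)
    · rw [abs_mul, abs_mul, abs_of_pos (by positivity : 0 < a + m),
        abs_of_nonneg (by positivity : 0 ≤ 2 * (m : ℝ) * W)]
    · rw [abs_mul, abs_of_nonneg e0]
  have b2 : J * ((a + m) * |P * Q - W| + 2 * m * W * |V - 1 / 2| + |V| * e) ≤
      ((a + m) * (2 * E ^ m) + 2 * m * G + (1 + G) * ((2 * m : ℕ) : ℝ) ^ 2) * W := by
    calc _ = (a + m) * (J * |P * Q - W|) + 2 * m * W * (J * |V - 1 / 2|) + |V| * (J * e) := by ring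
      _ ≤ (a + m) * (2 * E ^ m * W) + 2 * m * W * G + (1 + G) * (((2 * m : ℕ) : ℝ) ^ 2 * W) :=
        add_le_add (add_le_add (mul_le_mul_of_nonneg_left hPQ (by positivity))
          (mul_le_mul_of_nonneg_left hV2 (by positivity)))
          (mul_le_mul hV1 e1 (mul_nonneg hJ0.le e0) (by linarith))
      _ = _ := by ring
  rw [key, abs_mul, abs_of_pos hc]
  calc J * (c * |(a + m) * (P * Q - W) - 2 * m * W * (V - 1 / 2) + V * e|)
      = c * (J * |(a + m) * (P * Q - W) - 2 * m * W * (V - 1 / 2) + V * e|) := by ring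
    _ ≤ c * (F ^ m * W) :=
      mul_le_mul_of_nonneg_left ((mul_le_mul_of_nonneg_left b1 hJ0.le).trans
        (b2.trans (mul_le_mul_of_nonneg_right hF hW0.le))) hc.le
    _ = _ := by ring

/-- Sum the increments: their errors carry `(j+1)^(2(k+l)-1)`, at most its value at the last index,
times masses that add up to `jacobiMassSum`. -/
theorem jacobiMoment_bound (ha : 0 < a) (hb : 0 < b) :
    ∃ F : ℝ, 1 ≤ F ∧ ∀ k l n : ℕ, 0 < n →
      |jacobiMoment a b k l (n + 1) / (jacobiMassSum a b (n + 1) * (n : ℝ) ^ (2 * (k + l))) -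
          a / (a + (k + l : ℕ))| ≤ F ^ (k + l) / a / n := by
  obtain ⟨F, hF, hinc⟩ := jacobiMoment_increment_bound ha hb
  refine ⟨F, hF, fun k l n hn => ?_⟩
  have hC : 0 < jacobiMassSum a b (n + 1) := jacobiMassSum_pos ha hb n
  have hn0 : (0 : ℝ) < n := by exact_mod_cast hn
  rcases (k + l).eq_zero_or_pos with h0 | hm
  · obtain ⟨rfl, rfl⟩ : k = 0 ∧ l = 0 := by omega
    have : jacobiMoment a b 0 0 (n + 1) = jacobiMassSum a b (n + 1) := by
      simp [jacobiMoment, jacobiMassSum, pochPair]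
    rw [this]
    simp only [add_zero, mul_zero, pow_zero, mul_one, Nat.cast_zero, div_self hC.ne',
      div_self ha.ne', sub_self, abs_zero]
    positivity
  -- Then `2 * r + 1` is `2(k+l) - 1`, the exponent left after gaining one factor, without natural
  -- subtraction.
  obtain ⟨r, hr⟩ : ∃ r, k + l = r + 1 := ⟨k + l - 1, by omega⟩
  have main : ∀ n : ℕ, |(a + (k + l : ℕ)) * jacobiMoment a b k l (n + 1) -
      a * (jacobiMassSum a b (n + 1) * (n : ℝ) ^ (2 * (k + l)))| ≤
        F ^ (k + l) * (n : ℝ) ^ (2 * r + 1) * jacobiMassSum a b (n + 1) := by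
    intro n
    induction n with
    | zero =>
      have h1 : pochPair (a + b - 1) k 0 * pochPair (a + b - 1) l 0 = 0 := by
        rcases k.eq_zero_or_pos with rfl | hk
        · rw [pochPair_eq_zero (k := l) _ (by omega), mul_zero]
        · rw [pochPair_eq_zero _ hk, zero_mul]
      have h2 : 2 * (k + l) ≠ 0 := by omega
      simp only [Nat.cast_zero, zero_pow h2]
      simp [jacobiMoment, h1]
    | succ n ih =>
      have hn0 : (0 : ℝ) ≤ n := n.cast_nonneg
      have hJ0 : (0 : ℝ) < n + 1 := by linarith
      have hS : jacobiMassSum a b (n + 1 + 1) =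
        jacobiMassSum a b (n + 1) + jacobiMass a b (n + 1) := Finset.sum_range_succ _ _
      have hM : jacobiMoment a b k l (n + 1 + 1) = jacobiMoment a b k l (n + 1) +
          jacobiMass a b (n + 1) * (pochPair (a + b - 1) k (n + 1) *
            pochPair (a + b - 1) l (n + 1)) := Finset.sum_range_succ _ _
      have hi := hinc k l n hm
      have hc := jacobiMass_pos ha hb (n + 1)
      have hC := jacobiMassSum_pos ha hb n
      rw [hM]
      push_cast at hi ih ⊢
      have hpow : ((n : ℝ) + 1) ^ (2 * (k + l)) = (n + 1) * (n + 1) ^ (2 * r + 1) := by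
        rw [hr]; ring
      have hi' : |(a + ((k : ℝ) + l)) * (pochPair (a + b - 1) k (n + 1) *
          pochPair (a + b - 1) l (n + 1)) * jacobiMass a b (n + 1)
          - a * (jacobiMassSum a b (n + 2) * ((n : ℝ) + 1) ^ (2 * (k + l)) -
            jacobiMassSum a b (n + 1) * (n : ℝ) ^ (2 * (k + l)))| ≤
          F ^ (k + l) * ((n : ℝ) + 1) ^ (2 * r + 1) * jacobiMass a b (n + 1) := by
        refine le_of_mul_le_mul_left (hi.trans_eq ?_) hJ0
        rw [hpow]; ring
      have ih' : F ^ (k + l) * (n : ℝ) ^ (2 * r + 1) * jacobiMassSum a b (n + 1) ≤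
          F ^ (k + l) * ((n : ℝ) + 1) ^ (2 * r + 1) * jacobiMassSum a b (n + 1) := by
        gcongr
        linarith
      rw [show F ^ (k + l) * ((n : ℝ) + 1) ^ (2 * r + 1) * jacobiMassSum a b (n + 1 + 1) =
        F ^ (k + l) * ((n : ℝ) + 1) ^ (2 * r + 1) * jacobiMassSum a b (n + 1) +
        F ^ (k + l) * ((n : ℝ) + 1) ^ (2 * r + 1) * jacobiMass a b (n + 1) by rw [hS]; ring]
      refine le_trans (le_of_eq ?_) ((abs_add_le _ _).trans (add_le_add (ih.trans ih') hi'))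
      congr 1
      ring
  have h := main n
  have ham : 0 < a + ((k + l : ℕ) : ℝ) := by positivity
  have hp : (0 : ℝ) < (n : ℝ) ^ (2 * (k + l)) := by positivity
  have hpow : (n : ℝ) ^ (2 * (k + l)) = n * n ^ (2 * r + 1) := by rw [hr]; ring
  have e : jacobiMoment a b k l (n + 1) / (jacobiMassSum a b (n + 1) * (n : ℝ) ^ (2 * (k + l))) -
          a / (a + (k + l : ℕ)) =
      ((a + (k + l : ℕ)) * jacobiMoment a b k l (n + 1) -
        a * (jacobiMassSum a b (n + 1) * (n : ℝ) ^ (2 * (k + l)))) /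
      ((a + (k + l : ℕ)) * (jacobiMassSum a b (n + 1) * (n : ℝ) ^ (2 * (k + l)))) := by
    field_simp
  rw [e, abs_div, abs_of_pos (by positivity : 0 < (a + ((k + l : ℕ) : ℝ)) *
    (jacobiMassSum a b (n + 1) * (n : ℝ) ^ (2 * (k + l)))), div_le_iff₀ (by positivity)]
  refine h.trans ?_
  have hle : a ≤ a + ((k + l : ℕ) : ℝ) := le_add_of_nonneg_right (Nat.cast_nonneg _)
  calc F ^ (k + l) * (n : ℝ) ^ (2 * r + 1) * jacobiMassSum a b (n + 1)
      = F ^ (k + l) / a / n * (a * (jacobiMassSum a b (n + 1) * (n : ℝ) ^ (2 * (k + l)))) := by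
        rw [hpow]; field_simp
    _ ≤ _ := by gcongr

end moments

/-! ### The function `₀F₁` and its kernel. -/

/-- The coefficient `1 / (k! (a)_k)` of the hypergeometric series `₀F₁(a; w)`. -/
noncomputable def hypCoeff (a : ℝ) (k : ℕ) : ℝ :=
  1 / ((k.factorial : ℝ) * ∏ i ∈ Finset.range k, (a + i))

/-- The hypergeometric function `₀F₁(a; w)`. -/
noncomputable def hyp0F1 (a w : ℝ) : ℝ := ∑' k : ℕ, hypCoeff a k * w ^ k

/-- The term of the double series of `hypKernel`. -/
noncomputable def hypKernelTerm (a w v : ℝ) (p : ℕ × ℕ) : ℝ :=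
  hypCoeff a p.1 * w ^ p.1 * (hypCoeff a p.2 * v ^ p.2) * (a / (a + (p.1 + p.2 : ℕ)))

/-- The kernel `a ∫_0^1 t^{a-1} ₀F₁(a; tw) ₀F₁(a; tv) dt` as a double power series. -/
noncomputable def hypKernel (a w v : ℝ) : ℝ := ∑' p : ℕ × ℕ, hypKernelTerm a w v p

section hyp

variable {a : ℝ}

theorem hypCoeff_pos (ha : 0 < a) (k : ℕ) : 0 < hypCoeff a k := by
  have : 0 < ∏ i ∈ Finset.range k, (a + (i : ℝ)) := Finset.prod_pos fun i _ => by positivity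
  unfold hypCoeff; positivity

theorem hypCoeff_succ (ha : 0 < a) (k : ℕ) :
    ((k : ℝ) + 1) * (a + k) * hypCoeff a (k + 1) = hypCoeff a k := by
  have h1 : 0 < ∏ i ∈ Finset.range k, (a + (i : ℝ)) := Finset.prod_pos fun i _ => by positivity
  have h2 : 0 < a + (k : ℝ) := by positivity
  rw [hypCoeff, hypCoeff, Finset.prod_range_succ, Nat.factorial_succ]
  push_cast
  field_simp

theorem hypCoeff_add_one (ha : 0 < a) (k : ℕ) :
    ((k : ℝ) + 1) * hypCoeff a (k + 1) = hypCoeff (a + 1) k / a := by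
  have h1 : 0 < ∏ i ∈ Finset.range k, (a + 1 + (i : ℝ)) := Finset.prod_pos fun i _ => by positivity
  rw [hypCoeff, hypCoeff, prod_range_succ_shift, Nat.factorial_succ]
  push_cast
  field_simp

/-- Among the factors `a + i` only `i = 0` can be below `1`, so the series is dominated by a
multiple of the exponential series. -/
theorem summable_hypCoeff_mul_pow (ha : 0 < a) (w : ℝ) :
    Summable fun k => hypCoeff a k * w ^ k := by
  have hle : ∀ k, hypCoeff a k ≤ max 1 a⁻¹ / k.factorial := by
    intro k
    have hprod : 1 ≤ max 1 a⁻¹ * ∏ i ∈ Finset.range k, (a + (i : ℝ)) := by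
      cases k with
      | zero => simp
      | succ k =>
        rw [Finset.prod_range_succ']
        have : 1 ≤ ∏ i ∈ Finset.range k, (a + ((i + 1 : ℕ) : ℝ)) := by
          refine Finset.prod_const_one.symm.le.trans
            (Finset.prod_le_prod (fun _ _ => zero_le_one) fun i _ => ?_)
          push_cast
          have : (0 : ℝ) ≤ i := i.cast_nonneg
          linarith
        calc (1 : ℝ) = a⁻¹ * (1 * a) := by field_simp
          _ ≤ max 1 a⁻¹ * ((∏ i ∈ Finset.range k, (a + ((i + 1 : ℕ) : ℝ))) * a) := by
            gcongr
            exact le_max_right _ _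
          _ = _ := by simp
    have h1 : 0 < ∏ i ∈ Finset.range k, (a + (i : ℝ)) := Finset.prod_pos fun i _ => by positivity
    rw [hypCoeff, div_le_div_iff₀ (by positivity) (by positivity)]
    have : (0 : ℝ) < k.factorial := by positivity
    nlinarith
  refine Summable.of_norm_bounded ((Real.summable_pow_div_factorial |w|).mul_left (max 1 a⁻¹))
    fun k => ?_
  rw [norm_mul, norm_pow, Real.norm_eq_abs, Real.norm_eq_abs, abs_of_pos (hypCoeff_pos ha k)]
  calc _ ≤ max 1 a⁻¹ / k.factorial * |w| ^ k :=
        mul_le_mul_of_nonneg_right (hle k) (by positivity)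
    _ = _ := by ring

theorem hasSum_hyp0F1 (ha : 0 < a) (w : ℝ) :
    HasSum (fun k => hypCoeff a k * w ^ k) (hyp0F1 a w) :=
  (summable_hypCoeff_mul_pow ha w).hasSum

theorem hasDerivAt_hyp0F1 (ha : 0 < a) (w : ℝ) :
    HasDerivAt (hyp0F1 a) (hyp0F1 (a + 1) w / a) w := by
  have ha1 : 0 < a + 1 := by linarith
  set R := |w| + 1 with hR
  have hb : Summable fun k : ℕ => hypCoeff a k * (k * R ^ (k - 1)) := by
    rw [← summable_nat_add_iff 1]
    refine ((summable_hypCoeff_mul_pow ha1 R).div_const a).congr fun k => ?_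
    have := hypCoeff_add_one ha k
    push_cast
    linear_combination (-R ^ k) * this
  have h := hasDerivAt_tsum_of_isPreconnected (g := fun k (x : ℝ) => hypCoeff a k * x ^ k)
    (g' := fun k x => hypCoeff a k * (k * x ^ (k - 1))) (t := Metric.ball 0 R) (y₀ := w) (y := w)
    hb Metric.isOpen_ball (convex_ball (0 : ℝ) R).isPreconnected
    (fun k x _ => (hasDerivAt_pow k x).const_mul _)
    (fun k x hx => by
      have hx : |x| ≤ R := by simpa using (Metric.mem_ball.1 hx).le
      rw [norm_mul, norm_mul, norm_pow, Real.norm_eq_abs, Real.norm_eq_abs, Real.norm_eq_abs,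
        abs_of_pos (hypCoeff_pos ha k), Nat.abs_cast]
      have := hypCoeff_pos ha k
      gcongr)
    (by simp [hR]) (summable_hypCoeff_mul_pow ha w) (by simp [hR])
  refine h.congr_deriv (HasSum.tsum_eq ?_)
  rw [← hasSum_nat_add_iff' 1]
  simp only [Finset.sum_range_one, Nat.cast_zero, zero_mul, mul_zero, sub_zero]
  refine ((hasSum_hyp0F1 ha1 w).div_const a).congr_fun fun k => ?_
  have := hypCoeff_add_one ha k
  simp only [Nat.add_sub_cancel]
  push_cast
  linear_combination (w ^ k) * this

theorem hasSum_mul_hypCoeff_mul_pow (ha : 0 < a) (w : ℝ) :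
    HasSum (fun k : ℕ => (k : ℝ) * (hypCoeff a k * w ^ k)) (w * (hyp0F1 (a + 1) w / a)) := by
  rw [← hasSum_nat_add_iff' 1]
  simp only [Finset.sum_range_one, Nat.cast_zero, zero_mul, sub_zero]
  refine (((hasSum_hyp0F1 (by linarith : 0 < a + 1) w).div_const a).mul_left w).congr_fun
    fun k => ?_
  have := hypCoeff_add_one ha k
  push_cast
  linear_combination (w ^ (k + 1)) * this

/-- The differential equation `w F'' + a F' = F` of `F = ₀F₁(a; ·)`. -/
theorem hyp0F1_ode (ha : 0 < a) (w : ℝ) :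
    w * (hyp0F1 (a + 2) w / (a + 1)) / a + hyp0F1 (a + 1) w = hyp0F1 a w := by
  have ha1 : 0 < a + 1 := by linarith
  have h1 := (hasSum_mul_hypCoeff_mul_pow ha1 w).div_const a
  rw [show a + 1 + 1 = a + 2 by ring] at h1
  refine (h1.add (hasSum_hyp0F1 ha1 w)).unique ((hasSum_hyp0F1 ha w).congr_fun fun k => ?_)
  have e1 := hypCoeff_add_one ha k
  have e2 := hypCoeff_succ ha k
  rw [eq_div_iff ha.ne'] at e1
  rw [← e1, ← e2]
  field_simp
  ring

theorem summable_hypKernel_majorant (ha : 0 < a) (w v : ℝ) :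
    Summable fun p : ℕ × ℕ => hypCoeff a p.1 * w ^ p.1 * (hypCoeff a p.2 * v ^ p.2) :=
  summable_mul_of_summable_norm (summable_hypCoeff_mul_pow ha w).norm
    (summable_hypCoeff_mul_pow ha v).norm

theorem norm_hypKernelTerm_le (ha : 0 < a) {w v R : ℝ} (hw : |w| ≤ R) (hv : |v| ≤ R)
    (p : ℕ × ℕ) :
    ‖hypKernelTerm a w v p‖ ≤ hypCoeff a p.1 * R ^ p.1 * (hypCoeff a p.2 * R ^ p.2) := by
  have h1 := hypCoeff_pos ha p.1
  have h2 := hypCoeff_pos ha p.2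
  have h3 : (0 : ℝ) ≤ (p.1 + p.2 : ℕ) := Nat.cast_nonneg _
  have h4 : a / (a + (p.1 + p.2 : ℕ)) ≤ 1 := (div_le_one (by linarith)).2 (by linarith)
  have hR : 0 ≤ R := (abs_nonneg _).trans hw
  rw [hypKernelTerm, norm_mul, norm_mul, norm_mul, norm_mul, norm_pow, norm_pow]
  simp only [Real.norm_eq_abs]
  rw [abs_of_pos h1, abs_of_pos h2, abs_of_pos (by positivity : 0 < a / (a + (p.1 + p.2 : ℕ)))]
  calc _ ≤ hypCoeff a p.1 * |w| ^ p.1 * (hypCoeff a p.2 * |v| ^ p.2) :=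
        mul_le_of_le_one_right (by positivity) h4
    _ ≤ _ := by gcongr

theorem summable_hypKernelTerm (ha : 0 < a) (w v : ℝ) : Summable (hypKernelTerm a w v) :=
  Summable.of_norm_bounded (summable_hypKernel_majorant ha _ _)
    (norm_hypKernelTerm_le ha (le_max_left |w| |v|) (le_max_right |w| |v|))

theorem hasSum_hypKernel (ha : 0 < a) (w v : ℝ) :
    HasSum (hypKernelTerm a w v) (hypKernel a w v) :=
  (summable_hypKernelTerm ha w v).hasSum

theorem continuous_hypKernel_left (ha : 0 < a) (v : ℝ) : Continuous fun w => hypKernel a w v := by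
  rw [continuous_iff_continuousAt]
  intro w
  have hc : ContinuousOn (fun w => ∑' p, hypKernelTerm a w v p)
      (Metric.ball 0 (max (|w| + 1) |v|)) := by
    refine continuousOn_tsum (fun p => ?_) (summable_hypKernel_majorant ha _ _)
      fun p x hx => norm_hypKernelTerm_le ha
        (by simpa using (Metric.mem_ball.1 hx).le) (le_max_right _ _) p
    unfold hypKernelTerm
    fun_prop
  exact hc.continuousAt (Metric.isOpen_ball.mem_nhds (by simp))

/-- Multiplication by `w` is re-indexed so that it has the same monomials as multiplication by `v`;
subtracting the two then works coefficientwise. -/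
theorem hasSum_hypKernel_shift_left (ha : 0 < a) (w v : ℝ) :
    HasSum (fun p : ℕ × ℕ => hypCoeff a p.1 * w ^ p.1 * (hypCoeff a p.2 * v ^ p.2) *
      (a * (p.1 * (a + p.1 - 1)) / (a + p.1 + p.2 - 1))) (w * hypKernel a w v) := by
  have hinj : Function.Injective fun p : ℕ × ℕ => (p.1 + 1, p.2) := by
    rintro ⟨k, l⟩ ⟨k', l'⟩ h
    simpa using h
  refine (hinj.hasSum_iff ?_).1 (((hasSum_hypKernel ha w v).mul_left w).congr_fun fun p => ?_)
  · rintro ⟨k, l⟩ hp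
    cases k with
    | zero => simp
    | succ k => exact absurd ⟨(k, l), rfl⟩ hp
  · have e := hypCoeff_succ ha p.1
    simp only [Function.comp, hypKernelTerm, ← e]
    push_cast
    rw [show a + ((p.1 : ℝ) + 1) + p.2 - 1 = a + (p.1 + p.2) by ring]
    ring

theorem hypKernel_comm (ha : 0 < a) (w v : ℝ) : hypKernel a w v = hypKernel a v w := by
  refine (hasSum_hypKernel ha w v).unique (((Equiv.prodComm ℕ ℕ).hasSum_iff.2
    (hasSum_hypKernel ha v w)).congr_fun fun p => ?_)
  simp only [Function.comp, hypKernelTerm, Equiv.prodComm_apply, Prod.fst_swap, Prod.snd_swap,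
    add_comm p.2 p.1]
  ring

theorem hasSum_hypKernel_shift_right (ha : 0 < a) (w v : ℝ) :
    HasSum (fun p : ℕ × ℕ => hypCoeff a p.1 * w ^ p.1 * (hypCoeff a p.2 * v ^ p.2) *
      (a * (p.2 * (a + p.2 - 1)) / (a + p.1 + p.2 - 1))) (v * hypKernel a w v) := by
  rw [hypKernel_comm ha]
  refine ((Equiv.prodComm ℕ ℕ).hasSum_iff.2 (hasSum_hypKernel_shift_left ha v w)).congr_fun
    fun p => ?_
  simp only [Function.comp, Equiv.prodComm_apply, Prod.fst_swap, Prod.snd_swap]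
  rw [add_right_comm a (p.2 : ℝ)]
  ring

theorem hasSum_mul_prod {f g : ℕ → ℝ} {s t : ℝ} (hf : HasSum f s) (hg : HasSum g t) :
    HasSum (fun p : ℕ × ℕ => f p.1 * g p.2) (s * t) :=
  hf.mul hg (summable_mul_of_summable_norm hf.summable.norm hg.summable.norm)

/-- The Christoffel-Darboux identity for the kernel of `₀F₁(a; ·)`. -/
theorem sub_mul_hypKernel (ha : 0 < a) (w v : ℝ) :
    (w - v) * hypKernel a w v =
      w * hyp0F1 (a + 1) w * hyp0F1 a v - hyp0F1 a w * (v * hyp0F1 (a + 1) v) := by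
  have hf := hasSum_hyp0F1 ha
  have hk := hasSum_mul_hypCoeff_mul_pow ha
  have hw := hasSum_mul_prod (hk w) (hf v)
  have hv := hasSum_mul_prod (hf w) (hk v)
  have h1 := (hasSum_hypKernel_shift_left ha w v).sub (hasSum_hypKernel_shift_right ha w v)
  have h2 := (hw.sub hv).mul_left a
  have he : ∀ p : ℕ × ℕ, hypCoeff a p.1 * w ^ p.1 * (hypCoeff a p.2 * v ^ p.2) *
        (a * (p.1 * (a + p.1 - 1)) / (a + p.1 + p.2 - 1)) -
      hypCoeff a p.1 * w ^ p.1 * (hypCoeff a p.2 * v ^ p.2) *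
        (a * (p.2 * (a + p.2 - 1)) / (a + p.1 + p.2 - 1)) =
      a * ((p.1 : ℝ) * (hypCoeff a p.1 * w ^ p.1) * (hypCoeff a p.2 * v ^ p.2) -
        hypCoeff a p.1 * w ^ p.1 * ((p.2 : ℝ) * (hypCoeff a p.2 * v ^ p.2))) := by
    intro p
    generalize hypCoeff a p.1 * w ^ p.1 = X
    generalize hypCoeff a p.2 * v ^ p.2 = Y
    -- Only at `(0,0)` can the denominator `a + p.1 + p.2 - 1` vanish, and there both numerators are
    -- zero.
    rcases Nat.eq_zero_or_pos (p.1 + p.2) with h0 | h0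
    · obtain ⟨h3, h4⟩ : p.1 = 0 ∧ p.2 = 0 := by omega
      simp [h3, h4]
    · have : (1 : ℝ) ≤ p.1 + p.2 := by exact_mod_cast h0
      have hne : a + (p.1 : ℝ) + p.2 - 1 ≠ 0 := by linarith
      -- The difference `k(a+k-1) - l(a+l-1) = (k-l)(a+k+l-1)` cancels the denominator and decouples
      -- the double series.
      rw [← mul_sub, ← sub_div, show a * ((p.1 : ℝ) * (a + p.1 - 1)) - a * (p.2 * (a + p.2 - 1)) =
        a * (p.1 - p.2) * (a + p.1 + p.2 - 1) by ring, mul_div_cancel_right₀ _ hne]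
      ring
  have h3 := h1.unique (h2.congr_fun he)
  rw [sub_mul, h3]
  have ha' := ha.ne'
  generalize hyp0F1 (a + 1) w = A at *
  generalize hyp0F1 (a + 1) v = B at *
  field_simp

/-- By continuity the diagonal value is the derivative at `w = v` of the right side of
`sub_mul_hypKernel`; the differential equation eliminates `hyp0F1 (a + 2)`. -/
theorem hypKernel_self (ha : 0 < a) (v : ℝ) :
    hypKernel a v v = a * hyp0F1 a v ^ 2 -
      hyp0F1 (a + 1) v * (v * (hyp0F1 (a + 1) v / a) + (a - 1) * hyp0F1 a v) := by
  have ha1 : 0 < a + 1 := by linarith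
  have hd1 := hasDerivAt_hyp0F1 ha1 v
  have hd : HasDerivAt (fun w => (w - v) * hypKernel a w v) _ v :=
    ((((hasDerivAt_id v).mul hd1).mul_const (hyp0F1 a v)).sub
      ((hasDerivAt_hyp0F1 ha v).mul_const (v * hyp0F1 (a + 1) v))).congr_of_eventuallyEq
      (Filter.Eventually.of_forall fun w => sub_mul_hypKernel ha w v)
  have hs := hasDerivAt_iff_tendsto_slope.1 hd
  have ht : Filter.Tendsto (fun w => hypKernel a w v) (nhdsWithin v {v}ᶜ)
      (nhds (hypKernel a v v)) :=
    (continuous_hypKernel_left ha v).continuousAt.continuousWithinAt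
  have he : slope (fun w => (w - v) * hypKernel a w v) v =ᶠ[nhdsWithin v {v}ᶜ]
      fun w => hypKernel a w v := by
    filter_upwards [self_mem_nhdsWithin] with w hw
    have : w - v ≠ 0 := sub_ne_zero.2 hw
    rw [slope_def_field]
    field_simp
    simp
  rw [tendsto_nhds_unique ht (hs.congr' he)]
  have hode := hyp0F1_ode ha v
  rw [show a + 1 + 1 = a + 2 by ring]
  simp only [id]
  have h5 : v * (hyp0F1 (a + 2) v / (a + 1)) = a * (hyp0F1 a v - hyp0F1 (a + 1) v) := by
    rw [← hode]; field_simp; ring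
  rw [h5]
  ring

end hyp

/-! ### Bessel functions and the Bessel kernel through `₀F₁`. -/

section bessel

variable {a : ℝ}

theorem inv_factorial_mul_Gamma (ha : 0 < a) (k : ℕ) :
    1 / ((k.factorial : ℝ) * Real.Gamma (k + a)) = hypCoeff a k / Real.Gamma a := by
  have h1 : 0 < ∏ i ∈ Finset.range k, (a + (i : ℝ)) := Finset.prod_pos fun i _ => by positivity
  have hG := Real.Gamma_pos_of_pos ha
  rw [add_comm (k : ℝ), ← prod_range_add_mul_Gamma ha, hypCoeff]
  field_simp

theorem bessel_power_eq {x : ℝ} (hx : 0 < x) (ν : ℝ) (k : ℕ) :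
    (-1 : ℝ) ^ k * (x / 2) ^ (2 * (k : ℝ) + ν) = (x / 2) ^ ν * (-(x ^ 2) / 4) ^ k := by
  have h2 : 0 < x / 2 := by positivity
  rw [Real.rpow_add h2, show (2 * (k : ℝ)) = ((2 * k : ℕ) : ℝ) by push_cast; ring,
    Real.rpow_natCast, pow_mul, show -(x ^ 2) / 4 = (-1) * (x / 2) ^ 2 by ring, mul_pow]
  ring

theorem besselJ_sub_one (ha : 0 < a) {x : ℝ} (hx : 0 < x) :
    besselJ (a - 1) x = (x / 2) ^ (a - 1) / Real.Gamma a * hyp0F1 a (-(x ^ 2) / 4) := by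
  refine HasSum.tsum_eq (((hasSum_hyp0F1 ha (-(x ^ 2) / 4)).mul_left
    ((x / 2) ^ (a - 1) / Real.Gamma a)).congr_fun fun k => ?_)
  have h := inv_factorial_mul_Gamma ha k
  have hp := bessel_power_eq hx (a - 1) k
  rw [show (k : ℝ) + (a - 1) + 1 = k + a by ring]
  calc _ = 1 / ((k.factorial : ℝ) * Real.Gamma (k + a)) *
        ((-1 : ℝ) ^ k * (x / 2) ^ (2 * (k : ℝ) + (a - 1))) := by ring
    _ = _ := by rw [h, hp]; ring

theorem besselJ_sub_two (ha : 0 < a) {x : ℝ} (hx : 0 < x) :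
    besselJ (a - 1 - 1) x = (x / 2) ^ (a - 1 - 1) / Real.Gamma a *
      (-(x ^ 2) / 4 * (hyp0F1 (a + 1) (-(x ^ 2) / 4) / a) +
        (a - 1) * hyp0F1 a (-(x ^ 2) / 4)) := by
  refine HasSum.tsum_eq ((((hasSum_mul_hypCoeff_mul_pow ha (-(x ^ 2) / 4)).add
    ((hasSum_hyp0F1 ha (-(x ^ 2) / 4)).mul_left (a - 1))).mul_left
    ((x / 2) ^ (a - 1 - 1) / Real.Gamma a)).congr_fun fun k => ?_)
  have h := inv_factorial_mul_Gamma ha k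
  have hp := bessel_power_eq hx (a - 1 - 1) k
  have hG : 1 / ((k.factorial : ℝ) * Real.Gamma (k + a - 1)) =
      (k + a - 1) * (1 / ((k.factorial : ℝ) * Real.Gamma (k + a))) := by
    -- Since `k + a - 1 > -1`, the only possible pole is at `0`, where the value `Real.Gamma 0 = 0`
    -- makes both sides vanish.
    by_cases h0 : (k : ℝ) + a - 1 = 0
    · rw [h0, Real.Gamma_zero]; simp
    · rw [show (k : ℝ) + a = k + a - 1 + 1 by ring, Real.Gamma_add_one h0, add_sub_cancel_right]
      field_simp
  rw [show (k : ℝ) + (a - 1 - 1) + 1 = k + a - 1 by ring]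
  calc _ = 1 / ((k.factorial : ℝ) * Real.Gamma (k + a - 1)) *
        ((-1 : ℝ) ^ k * (x / 2) ^ (2 * (k : ℝ) + (a - 1 - 1))) := by ring
    _ = _ := by rw [hG, h, hp]; ring

theorem mul_deriv_besselJ (ha : 0 < a) {x : ℝ} (hx : 0 < x) :
    x * deriv (besselJ (a - 1)) x = (x / 2) ^ (a - 1) / Real.Gamma a *
      ((a - 1) * hyp0F1 a (-(x ^ 2) / 4) +
        2 * (-(x ^ 2) / 4) * (hyp0F1 (a + 1) (-(x ^ 2) / 4) / a)) := by
  have h2 : 0 < x / 2 := by positivity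
  have h1 : HasDerivAt (fun t : ℝ => (t / 2) ^ (a - 1)) _ x :=
    ((hasDerivAt_id x).div_const 2).rpow_const (Or.inl h2.ne')
  have h3 : HasDerivAt (fun t : ℝ => -(t ^ 2) / 4) (-(2 * x) / 4) x := by
    simpa using ((hasDerivAt_pow 2 x).neg).div_const 4
  have h4 : HasDerivAt (fun t : ℝ => hyp0F1 a (-(t ^ 2) / 4)) _ x :=
    (hasDerivAt_hyp0F1 ha _).comp x h3
  have h5 := ((h1.div_const (Real.Gamma a)).mul h4).congr_of_eventuallyEq
    (f₁ := besselJ (a - 1))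
    (by filter_upwards [lt_mem_nhds hx] with t ht using besselJ_sub_one ha ht)
  rw [h5.deriv, id, Real.rpow_sub_one h2.ne' (a - 1)]
  field_simp

theorem besselKernel_sub_one (ha : 0 < a) {x y : ℝ} (hx : 0 < x) (hy : 0 < y) :
    besselKernel (a - 1) x y = (√x / 2) ^ (a - 1) * (√y / 2) ^ (a - 1) /
      (4 * a * Real.Gamma a ^ 2) * hypKernel a (-x / 4) (-y / 4) := by
  have hsx := Real.sqrt_pos.2 hx
  have hsy := Real.sqrt_pos.2 hy
  have hG := Real.Gamma_pos_of_pos ha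
  have ha1 : 0 < a + 1 := by linarith
  have ex : -(√x ^ 2) / 4 = -x / 4 := by rw [Real.sq_sqrt hx.le]
  have ey : -(√y ^ 2) / 4 = -y / 4 := by rw [Real.sq_sqrt hy.le]
  have jx := besselJ_sub_one ha hsx
  have jy := besselJ_sub_one ha hsy
  rw [ex] at jx
  rw [ey] at jy
  rw [besselKernel]
  split_ifs with h
  · subst h
    have j1 := besselJ_sub_one ha1 hsx
    have j2 := besselJ_sub_two ha hsx
    rw [ex] at j1 j2
    rw [show a + 1 - 1 = a - 1 + 1 by ring] at j1
    have h2 : 0 < √x / 2 := by positivity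
    rw [jx, j1, j2, hypKernel_self ha, Real.rpow_add_one h2.ne', Real.rpow_sub_one h2.ne' (a - 1),
      Real.Gamma_add_one ha.ne']
    field_simp
  · have dx := mul_deriv_besselJ ha hsx
    have dy := mul_deriv_besselJ ha hsy
    rw [ex] at dx
    rw [ey] at dy
    have hxy : x - y ≠ 0 := sub_ne_zero.2 h
    have hk := sub_mul_hypKernel ha (-x / 4) (-y / 4)
    rw [mul_assoc, dy, mul_comm (deriv _ _), dx, jx, jy,
      div_eq_iff (mul_ne_zero two_ne_zero hxy)]
    generalize (√x / 2) ^ (a - 1) = u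
    generalize (√y / 2) ^ (a - 1) = v
    have hk' : hypKernel a (-x / 4) (-y / 4) * (x - y) =
      x * hyp0F1 (a + 1) (-x / 4) * hyp0F1 a (-y / 4) -
        hyp0F1 a (-x / 4) * (y * hyp0F1 (a + 1) (-y / 4)) := by linear_combination (-4) * hk
    calc _ = u * v / (4 * a * Real.Gamma a ^ 2) * 2 *
          (x * hyp0F1 (a + 1) (-x / 4) * hyp0F1 a (-y / 4) -
            hyp0F1 a (-x / 4) * (y * hyp0F1 (a + 1) (-y / 4))) := by
          field_simp
          ring
      _ = _ := by rw [← hk']; ring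

end bessel

/-! ### Double series of the Jacobi kernel and its limit. -/

section expansion

variable {a b : ℝ}

theorem choose_mul_factorial_eq_prod (j k : ℕ) :
    (j.choose k : ℝ) * k.factorial = ∏ i ∈ Finset.range k, ((j : ℝ) - i) := by
  rcases lt_or_ge j k with h | h
  · rw [Nat.choose_eq_zero_of_lt h, Finset.prod_eq_zero (Finset.mem_range.2 h) (by simp)]
    simp
  · rw [mul_comm, ← Nat.cast_mul, ← Nat.descFactorial_eq_factorial_mul_choose,
      Nat.descFactorial_eq_prod_range, Nat.cast_prod]
    refine Finset.prod_congr rfl fun i hi => ?_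
    rw [Nat.cast_sub ((Finset.mem_range.1 hi).le.trans h)]

theorem jacobiCoeff_sub_one (ha : 0 < a) {j k : ℕ} (hk : k ≤ j) :
    jacobiCoeff (a - 1) (b - 1) j k = (∏ i ∈ Finset.range j, (a + (i : ℝ))) / j.factorial *
      (pochPair (a + b - 1) k j * hypCoeff a k) := by
  have h1 : ∏ i ∈ Finset.range k, (a + (i : ℝ)) ≠ 0 :=
    (Finset.prod_pos fun i _ => by positivity).ne'
  have h2 : ∏ i ∈ Finset.range k, ((j : ℝ) + (a - 1) + (b - 1) + 1 + i) =
      ∏ i ∈ Finset.range k, ((j : ℝ) + (a + b - 1) + i) :=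
    Finset.prod_congr rfl fun i _ => by ring
  have h3 : ∏ i ∈ Finset.Ico k j, (a - 1 + 1 + (i : ℝ)) = ∏ i ∈ Finset.Ico k j, (a + (i : ℝ)) := by
    rw [sub_add_cancel]
  have h4 := Finset.prod_range_mul_prod_Ico (fun i : ℕ => a + (i : ℝ)) hk
  have hkf : (k.factorial : ℝ) ≠ 0 := by positivity
  have hc := choose_mul_factorial_eq_prod j k
  rw [← eq_div_iff hkf] at hc
  rw [jacobiCoeff, pochPair, Finset.prod_mul_distrib, hypCoeff, h2, h3, ← h4, hc]
  field_simp

/-- The range is common to all `j < n`, since `pochPair` vanishes for `k > j`; the sum over `j` can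
then be taken inside. -/
theorem jacobiP_sub_one_eq (ha : 0 < a) {j n : ℕ} (hj : j < n) (x : ℝ) :
    jacobiP (a - 1) (b - 1) j x = (∏ i ∈ Finset.range j, (a + (i : ℝ))) / j.factorial *
      ∑ k ∈ Finset.range n, pochPair (a + b - 1) k j * (hypCoeff a k * ((x - 1) / 2) ^ k) := by
  have hsub : Finset.range (j + 1) ⊆ Finset.range n := Finset.range_subset_range.2 hj
  rw [jacobiP_eq_sum, ← Finset.sum_subset hsub fun k _ hk => by
    rw [pochPair_eq_zero _ (by simpa using hk), zero_mul], Finset.mul_sum]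
  refine Finset.sum_congr rfl fun k hk => ?_
  rw [jacobiCoeff_sub_one ha (Nat.lt_succ_iff.1 (Finset.mem_range.1 hk))]
  ring

/-- The Christoffel-Darboux kernel of the Jacobi polynomials with parameters `(a-1, b-1)`. -/
noncomputable def jacobiKernel (a b : ℝ) (n : ℕ) (x y : ℝ) : ℝ :=
  ∑ j ∈ Finset.range n, jacobiP (a - 1) (b - 1) j x * jacobiP (a - 1) (b - 1) j y /
    jacobiNormSq (a - 1) (b - 1) j

/-- A finite sum put over all of `ℕ × ℕ`, for termwise comparison with `hypKernel`. -/
theorem hasSum_jacobiKernel (ha : 0 < a) (n : ℕ) (x y : ℝ) :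
    HasSum (fun p : ℕ × ℕ => jacobiMoment a b p.1 p.2 n *
      (hypCoeff a p.1 * ((x - 1) / 2) ^ p.1 * (hypCoeff a p.2 * ((y - 1) / 2) ^ p.2)))
      (jacobiKernel a b n x y) := by
  have hz : ∀ p ∉ Finset.range n ×ˢ Finset.range n, jacobiMoment a b p.1 p.2 n *
      (hypCoeff a p.1 * ((x - 1) / 2) ^ p.1 * (hypCoeff a p.2 * ((y - 1) / 2) ^ p.2)) = 0 := by
    intro p hp
    have : jacobiMoment a b p.1 p.2 n = 0 := by
      refine Finset.sum_eq_zero fun j hj => ?_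
      have hj := Finset.mem_range.1 hj
      rw [Finset.mem_product, Finset.mem_range, Finset.mem_range, not_and_or] at hp
      rcases hp with hp | hp
      · rw [pochPair_eq_zero _ (by omega : j < p.1)]; ring
      · rw [pochPair_eq_zero _ (by omega : j < p.2)]; ring
    rw [this, zero_mul]
  have h := hasSum_sum_of_ne_finset_zero (L := SummationFilter.unconditional _) hz
  refine (?_ : _ = jacobiKernel a b n x y) ▸ h
  simp only [jacobiMoment, Finset.sum_mul]
  rw [Finset.sum_comm, jacobiKernel]
  refine Finset.sum_congr rfl fun j hj => ?_
  have hj := Finset.mem_range.1 hj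
  rw [jacobiP_sub_one_eq ha hj x, jacobiP_sub_one_eq ha hj y, Finset.sum_product]
  symm
  calc _ = jacobiMass a b j *
        ((∑ k ∈ Finset.range n, pochPair (a + b - 1) k j * (hypCoeff a k * ((x - 1) / 2) ^ k)) *
        ∑ k ∈ Finset.range n, pochPair (a + b - 1) k j * (hypCoeff a k * ((y - 1) / 2) ^ k)) := by
        rw [jacobiMass]; ring
    _ = _ := by
      rw [Finset.sum_mul_sum, Finset.mul_sum]
      refine Finset.sum_congr rfl fun k _ => ?_
      rw [Finset.mul_sum]
      refine Finset.sum_congr rfl fun l _ => ?_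
      ring

/-- The normalized Jacobi kernel near the endpoint `1` converges to the `₀F₁` kernel. -/
theorem approxOn_jacobiKernel (ha : 0 < a) (hb : 0 < b) {S : Set (ℝ × ℝ)} {R : ℝ}
    (hS : ∀ p ∈ S, |p.1| ≤ R ∧ |p.2| ≤ R) :
    ApproxOn S (fun N p => jacobiKernel a b (2 * N + 1) (1 - p.1 / (8 * (N : ℝ) ^ 2))
        (1 - p.2 / (8 * (N : ℝ) ^ 2)) / jacobiMassSum a b (2 * N + 1))
      (fun p => hypKernel a (-p.1 / 4) (-p.2 / 4)) := by
  obtain ⟨F, hF, hM⟩ := jacobiMoment_bound ha hb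
  have hmaj := fun r : ℝ => summable_hypKernel_majorant ha r r
  have hq : ∀ x : ℝ, |x| ≤ R → |-x / 4| ≤ R / 4 := fun x hx => by
    rw [abs_div, abs_neg, abs_of_pos (by norm_num : (0 : ℝ) < 4)]; linarith
  refine ⟨⟨_, fun p hp => tsum_of_norm_bounded (hmaj (R / 4)).hasSum
    (norm_hypKernelTerm_le ha (hq _ (hS p hp).1) (hq _ (hS p hp).2))⟩,
    (∑' p : ℕ × ℕ, hypCoeff a p.1 * (R / 4 * F) ^ p.1 * (hypCoeff a p.2 * (R / 4 * F) ^ p.2)) / a,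
    1, fun N hN p hp => ?_⟩
  have hN1 : (1 : ℝ) ≤ N := by exact_mod_cast hN
  have hN0 : (0 : ℝ) < N := by linarith
  have hC := jacobiMassSum_pos ha hb (2 * N)
  have h1 := ((hasSum_jacobiKernel (b := b) ha (2 * N + 1) (1 - p.1 / (8 * (N : ℝ) ^ 2))
    (1 - p.2 / (8 * (N : ℝ) ^ 2))).div_const (jacobiMassSum a b (2 * N + 1))).sub
    (hasSum_hypKernel ha (-p.1 / 4) (-p.2 / 4))
  rw [← h1.tsum_eq, ← Real.norm_eq_abs]
  -- The factor `F^(k+l)` of the moment error is absorbed by enlarging the radius from `R / 4` to `R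
  -- / 4 * F`.
  refine tsum_of_norm_bounded (((hmaj (R / 4 * F)).hasSum.div_const a).div_const (N : ℝ))
    fun q => ?_
  have hm := hM q.1 q.2 (2 * N) (by omega)
  have hpow : ∀ (x : ℝ) (k : ℕ), ((1 - x / (8 * (N : ℝ) ^ 2) - 1) / 2) ^ k =
      (-x / 4) ^ k / ((2 * N : ℕ) : ℝ) ^ (2 * k) := by
    intro x k
    rw [pow_mul, ← div_pow]
    congr 1
    push_cast
    field_simp
    ring
  have h2N : (0 : ℝ) < ((2 * N : ℕ) : ℝ) := by exact_mod_cast (by omega : 0 < 2 * N)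
  have hNN : (N : ℝ) ≤ ((2 * N : ℕ) : ℝ) := by push_cast; linarith
  have c1 := hypCoeff_pos ha q.1
  have c2 := hypCoeff_pos ha q.2
  have hR : 0 ≤ R / 4 := (abs_nonneg _).trans (hq _ (hS p hp).1)
  have e : jacobiMoment a b q.1 q.2 (2 * N + 1) *
        (hypCoeff a q.1 * ((1 - p.1 / (8 * (N : ℝ) ^ 2) - 1) / 2) ^ q.1 *
          (hypCoeff a q.2 * ((1 - p.2 / (8 * (N : ℝ) ^ 2) - 1) / 2) ^ q.2)) /
        jacobiMassSum a b (2 * N + 1) - hypKernelTerm a (-p.1 / 4) (-p.2 / 4) q =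
      hypCoeff a q.1 * (-p.1 / 4) ^ q.1 * (hypCoeff a q.2 * (-p.2 / 4) ^ q.2) *
        (jacobiMoment a b q.1 q.2 (2 * N + 1) / (jacobiMassSum a b (2 * N + 1) *
          ((2 * N : ℕ) : ℝ) ^ (2 * (q.1 + q.2))) - a / (a + (q.1 + q.2 : ℕ))) := by
    rw [hpow, hpow, hypKernelTerm, mul_sub, mul_add, pow_add]
    congr 1
    field_simp
  rw [e, norm_mul, norm_mul, norm_mul, norm_mul, norm_pow, norm_pow]
  simp only [Real.norm_eq_abs]
  rw [abs_of_pos c1, abs_of_pos c2]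
  have b1 := pow_le_pow_left₀ (abs_nonneg _) (hq _ (hS p hp).1) q.1
  have b2 := pow_le_pow_left₀ (abs_nonneg _) (hq _ (hS p hp).2) q.2
  have hm' : F ^ (q.1 + q.2) / a / ((2 * N : ℕ) : ℝ) ≤ F ^ (q.1 + q.2) / a / N :=
    div_le_div_of_nonneg_left (by positivity) hN0 hNN
  calc _ ≤ hypCoeff a q.1 * (R / 4) ^ q.1 * (hypCoeff a q.2 * (R / 4) ^ q.2) *
        (F ^ (q.1 + q.2) / a / N) :=
      mul_le_mul (mul_le_mul (mul_le_mul_of_nonneg_left b1 c1.le)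
        (mul_le_mul_of_nonneg_left b2 c2.le) (by positivity) (by positivity))
        (hm.trans hm') (abs_nonneg _) (by positivity)
    _ = _ := by rw [mul_pow, mul_pow, pow_add]; ring

end expansion

/-! ### Prefactors and conclusion. -/

theorem one_sub_mul_phi4_mul_phi4 {a b : ℝ} (ha : 0 < a) (hb : 0 < b) (j : ℕ) {x y : ℝ}
    (hx : 0 < 1 - x) (hx' : 0 < 1 + x) :
    (1 - x ^ 2) * phi4 a b j x * phi4 a b j y =
      (1 - x) ^ (a / 2) * (1 + x) ^ (b / 2) * ((1 - y) ^ (a / 2 - 1) * (1 + y) ^ (b / 2 - 1)) *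
        (jacobiP (a - 1) (b - 1) j x * jacobiP (a - 1) (b - 1) j y /
          jacobiNormSq (a - 1) (b - 1) j) := by
  have hh := jacobiNormSq_sub_one_pos ha hb j
  have hs := Real.sqrt_pos.2 hh
  have h1 : (1 - x) ^ (a / 2) = (1 - x) ^ (a / 2 - 1) * (1 - x) := by
    rw [← Real.rpow_add_one hx.ne', sub_add_cancel]
  have h2 : (1 + x) ^ (b / 2) = (1 + x) ^ (b / 2 - 1) * (1 + x) := by
    rw [← Real.rpow_add_one hx'.ne', sub_add_cancel]
  rw [phi4, phi4, h1, h2]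
  nth_rewrite 3 [← Real.sq_sqrt hh.le]
  field_simp
  ring

theorem S4_eq {a b : ℝ} (ha : 0 < a) (hb : 0 < b) (N : ℕ) {x y : ℝ}
    (hx : 0 < 1 - x) (hx' : 0 < 1 + x) :
    S4 a b N x y =
      (1 - x) ^ (a / 2) * (1 + x) ^ (b / 2) * ((1 - y) ^ (a / 2 - 1) * (1 + y) ^ (b / 2 - 1)) *
        jacobiKernel a b (2 * N + 1) x y := by
  rw [S4, jacobiKernel, Finset.mul_sum]
  exact Finset.sum_congr rfl fun j _ => one_sub_mul_phi4_mul_phi4 ha hb j hx hx'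

/-- With `M = 8N²` the powers of `M` collect to `M^(-a)`, and `M^a = 2^a (2N)^(2a)` supplies the
normalization of `jacobiMassSum`. The bounds by `16N²` keep both points to the right of `-1`. -/
theorem scaled_S4_eq {a b : ℝ} (ha : 0 < a) (hb : 0 < b) {N : ℕ} {x y : ℝ} (hN : 0 < N)
    (hx : 0 < x) (hy : 0 < y) (hxN : x < 16 * (N : ℝ) ^ 2) (hyN : y < 16 * (N : ℝ) ^ 2) :
    1 / (8 * (N : ℝ) ^ 2) * S4 a b N (1 - x / (8 * (N : ℝ) ^ 2)) (1 - y / (8 * (N : ℝ) ^ 2)) =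
      x ^ (a / 2) * y ^ (a / 2 - 1) * (2 ^ (b - 1) / 2 ^ a) *
        ((1 + -x / (16 * (N : ℝ) ^ 2)) ^ (b / 2) * (1 + -y / (16 * (N : ℝ) ^ 2)) ^ (b / 2 - 1)) *
        (jacobiMassSum a b (2 * N + 1) / ((2 * N : ℕ) : ℝ) ^ (2 * a)) *
        (jacobiKernel a b (2 * N + 1) (1 - x / (8 * (N : ℝ) ^ 2)) (1 - y / (8 * (N : ℝ) ^ 2)) /
          jacobiMassSum a b (2 * N + 1)) := by
  have hN0 : (0 : ℝ) < N := by exact_mod_cast hN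
  have hC := jacobiMassSum_pos ha hb (2 * N)
  obtain ⟨M, hM⟩ : ∃ M : ℝ, M = 8 * (N : ℝ) ^ 2 := ⟨_, rfl⟩
  have hM0 : 0 < M := by rw [hM]; positivity
  have hM2 : (16 : ℝ) * (N : ℝ) ^ 2 = 2 * M := by rw [hM]; ring
  rw [hM2] at hxN hyN
  have hsplit : ∀ z : ℝ, 1 + (1 - z / M) = 2 * (1 + -z / (2 * M)) := by
    intro z; field_simp; ring
  have hpos : ∀ z : ℝ, z < 2 * M → 0 < 1 + -z / (2 * M) := by
    intro z hz
    have : 1 + -z / (2 * M) = (2 * M - z) / (2 * M) := by field_simp; ring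
    rw [this]
    exact div_pos (by linarith) (by positivity)
  have hMa : (2 : ℝ) ^ a * ((2 * N : ℕ) : ℝ) ^ (2 * a) = M ^ a := by
    have h2N : (0 : ℝ) ≤ ((2 * N : ℕ) : ℝ) := Nat.cast_nonneg _
    rw [Real.rpow_mul h2N, ← Real.mul_rpow (by norm_num) (by positivity), Real.rpow_two, hM]
    congr 1
    push_cast
    ring
  have hM1 : M ^ (a / 2) * M ^ (a / 2 - 1) * M = M ^ a := by
    rw [mul_assoc, ← Real.rpow_add_one hM0.ne', ← Real.rpow_add hM0]
    congr 1; ring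
  have hb2 : (2 : ℝ) ^ (b / 2) * 2 ^ (b / 2 - 1) = 2 ^ (b - 1) := by
    rw [← Real.rpow_add two_pos]; congr 1; ring
  rw [← hM, hM2, S4_eq ha hb N (by rw [sub_sub_cancel]; positivity)
    (by rw [hsplit]; have := hpos x hxN; positivity), sub_sub_cancel, sub_sub_cancel, hsplit,
    hsplit, Real.mul_rpow two_pos.le (hpos x hxN).le, Real.mul_rpow two_pos.le (hpos y hyN).le,
    Real.div_rpow hx.le hM0.le, Real.div_rpow hy.le hM0.le, ← hb2]
  have hpa : 0 < M ^ (a / 2) := Real.rpow_pos_of_pos hM0 _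
  have hpa1 : 0 < M ^ (a / 2 - 1) := Real.rpow_pos_of_pos hM0 _
  have h2a : (0 : ℝ) < 2 ^ a := Real.rpow_pos_of_pos two_pos _
  have h2N : 0 < ((2 * N : ℕ) : ℝ) ^ (2 * a) :=
    Real.rpow_pos_of_pos (by exact_mod_cast (by omega : 0 < 2 * N)) _
  have hfac : (1 : ℝ) / (2 ^ a * ((2 * N : ℕ) : ℝ) ^ (2 * a)) =
      1 / (M ^ (a / 2) * M ^ (a / 2 - 1) * M) := by rw [hMa, hM1]
  generalize jacobiKernel a b (2 * N + 1) (1 - x / M) (1 - y / M) = D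
  generalize (1 + -x / (2 * M)) ^ (b / 2) = u
  generalize (1 + -y / (2 * M)) ^ (b / 2 - 1) = v
  generalize x ^ (a / 2) = X
  generalize y ^ (a / 2 - 1) = Y
  generalize (2 : ℝ) ^ (b / 2) = B
  generalize (2 : ℝ) ^ (b / 2 - 1) = B'
  calc _ = X * Y * B * B' * u * v * D * (1 / (M ^ (a / 2) * M ^ (a / 2 - 1) * M)) := by
        field_simp
    _ = _ := by rw [← hfac]; field_simp

/-- The powers of `2` involving `b` cancel; they are kept to match the limits of the factors in
`scaled_S4_eq`. -/
theorem sqrt_div_mul_besselKernel {a b x y : ℝ} (ha : 0 < a) (hx : 0 < x) (hy : 0 < y) :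
    √(x / y) * besselKernel (a - 1) x y =
      x ^ (a / 2) * y ^ (a / 2 - 1) * (2 ^ (b - 1) / 2 ^ a) *
        (1 / (2 ^ (a + b - 1) * Real.Gamma a * Real.Gamma (a + 1))) *
        hypKernel a (-x / 4) (-y / 4) := by
  have hG := Real.Gamma_pos_of_pos ha
  have h2a : (0 : ℝ) < 2 ^ a := Real.rpow_pos_of_pos two_pos _
  have h2b : (0 : ℝ) < 2 ^ (b - 1) := Real.rpow_pos_of_pos two_pos _
  have hpow : ∀ z : ℝ, 0 < z → (√z / 2) ^ (a - 1) = z ^ (a / 2 - 1) * √z * 2 / 2 ^ a := by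
    intro z hz
    rw [Real.div_rpow (Real.sqrt_nonneg z) two_pos.le, Real.rpow_sub_one two_ne_zero,
      Real.sqrt_eq_rpow, ← Real.rpow_mul hz.le, ← Real.rpow_add hz]
    rw [show 1 / 2 * (a - 1) = a / 2 - 1 + 1 / 2 by ring]
    field_simp
  rw [besselKernel_sub_one ha hx hy, hpow x hx, hpow y hy, Real.sqrt_div hx.le,
    Real.Gamma_add_one ha.ne', show a + b - 1 = a + (b - 1) by ring, Real.rpow_add two_pos,
    show x ^ (a / 2) = x ^ (a / 2 - 1) * (√x * √x) by
      rw [Real.mul_self_sqrt hx.le, ← Real.rpow_add_one hx.ne', sub_add_cancel]]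
  have hsy := Real.sqrt_pos.2 hy
  field_simp
  norm_num



theorem mainTheorem8 (a b : ℝ) (ha : 0 < a) (hb : 0 < b)
    (K : Set ℝ) (hK : IsCompact K) (hKpos : K ⊆ Set.Ioi 0) :
    ∃ (C : ℝ) (N₀ : ℕ), ∀ N : ℕ, N₀ ≤ N → ∀ x ∈ K, ∀ y ∈ K,
      |1 / (8 * (N : ℝ) ^ 2) *
            S4 a b N (1 - x / (8 * (N : ℝ) ^ 2)) (1 - y / (8 * (N : ℝ) ^ 2)) -
          √(x / y) * besselKernel (a - 1) x y| ≤ C / (N : ℝ) := by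
  obtain ⟨R, hR⟩ := hK.isBounded.exists_norm_le
  have hS : ∀ p ∈ K ×ˢ K, |p.1| ≤ R ∧ |p.2| ≤ R := fun p hp => ⟨hR _ hp.1, hR _ hp.2⟩
  have hsmall : ∀ f : ℝ × ℝ → ℝ, (∀ p ∈ K ×ˢ K, |f p| ≤ R) → ∀ r : ℝ,
      ApproxOn (K ×ˢ K) (fun N p => (1 + -f p / (16 * (N : ℝ) ^ 2)) ^ r) (fun _ => 1) := by
    refine fun f hf r => ApproxOn.one_add_rpow R 1 (fun N hN p hp => ?_) r
    have hN1 : (1 : ℝ) ≤ N := by exact_mod_cast hN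
    rw [abs_div, abs_neg, abs_of_pos (by positivity : 0 < 16 * (N : ℝ) ^ 2)]
    exact div_le_div₀ ((abs_nonneg _).trans (hf p hp)) (hf p hp) (by linarith) (by nlinarith)
  -- The exponent `a / 2 - 1` may be negative, so boundedness relies on `K` being compact and away
  -- from `0`.
  have hbdd : ∃ B : ℝ, ∀ p ∈ K ×ˢ K,
      |p.1 ^ (a / 2) * p.2 ^ (a / 2 - 1) * (2 ^ (b - 1) / 2 ^ a)| ≤ B := by
    suffices h : ContinuousOn (fun p : ℝ × ℝ => p.1 ^ (a / 2) * p.2 ^ (a / 2 - 1) *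
        (2 ^ (b - 1) / 2 ^ a)) (K ×ˢ K) from (hK.prod hK).exists_bound_of_continuousOn h
    refine ((continuousOn_fst.rpow_const fun p hp => Or.inl ?_).mul
      (continuousOn_snd.rpow_const fun p hp => Or.inl ?_)).mul continuousOn_const
    · exact (hKpos hp.1 : 0 < p.1).ne'
    · exact (hKpos hp.2 : 0 < p.2).ne'
  have h := (((ApproxOn.const hbdd).mul ((hsmall Prod.fst (fun p hp => (hS p hp).1) (b / 2)).mul
    (hsmall Prod.snd (fun p hp => (hS p hp).2) (b / 2 - 1)))).mul
    (approxOn_jacobiMassSum (K ×ˢ K) ha hb)).mul (approxOn_jacobiKernel ha hb hS)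
  obtain ⟨-, C, N₀, hC⟩ := h
  obtain ⟨N₁, hN₁⟩ := exists_nat_gt R
  refine ⟨C, max (max N₀ N₁) 1, fun N hN x hx y hy => ?_⟩
  have hN1 : (1 : ℝ) ≤ N := by exact_mod_cast (le_max_right _ _).trans hN
  have hN2 : (N₁ : ℝ) ≤ N := by
    exact_mod_cast ((le_max_right _ _).trans (le_max_left _ _)).trans hN
  have hlt : ∀ z ∈ K, z < 16 * (N : ℝ) ^ 2 := fun z hz => by
    have := (le_abs_self z).trans (hR z hz)
    nlinarith
  have hC := hC N (((le_max_left _ _).trans (le_max_left _ _)).trans hN) (x, y) ⟨hx, hy⟩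
  rw [scaled_S4_eq ha hb ((le_max_right _ _).trans hN) (hKpos hx) (hKpos hy) (hlt x hx) (hlt y hy),
    sqrt_div_mul_besselKernel (b := b) ha (hKpos hx) (hKpos hy)]
  simpa only [mul_one] using hC
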